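/- **Setting.** Let $M$ be a finite-horizon MDP with finite non-empty state and action spaces $\mathcal S,\mathcal A$, horizon $H$, deterministic rewards $r_h:\mathcal S\times\mathcal A\to[0,1]$ and nominal transition vectors $P^o_{h,s,a}\in\Delta(\mathcal S)$, $h\in[H]$. For $\rho>0$ let $\mathcal P_{h,s,a}=\{P\in\Delta(\mathcal S): D_{\mathrm{KL}}(P,P^o_{h,s,a})\le\rho\}$, where $D_{\mathrm{KL}}(P,Q)=\sum_{s'}P(s')\log\frac{P(s')}{Q(s')}$ ($=\infty$ unless $P\ll Q$), let $\mathcal P=\bigotimes_{h,s,a}\mathcal P_{h,s,a}$, and write $L_{\mathcal P_{h,s,a}}V=\inf\{PV:P\in\mathcal P_{h,s,a}\}$. For a deterministic Markov policy $\pi$ let $V_h^{\pi}(s)=\inf_{P\in\mathcal P}\mathbb E_{\pi,P}[\sum_{t=h}^H r_t(s_t,a_t)\mid s_h=s]$, let $V_h^*=\sup_\pi V_h^\pi$, and $V^\pi=V^\pi_1$, $V^*=V_1^*$ (all of them are $0$ at time $H+1$). **Algorithm (RPVL).** Draw $N$ independent samples from each $P^o_{h,s,a}$ (all samples independent; $N_{\rm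 total}=N|\mathcal S||\mathcal A|H$), let $\widehat P^o_{h,s,a}$ be the empirical frequencies and $\widehat{\mathcal P}_{h,s,a}$ the KL ball of radius $\rho$ around $\widehat P^o_{h,s,a}$. Put $\widehat V_{H+1}=0$ and, for $h=H,\dots,1$, $\widehat V_h(s)=\max_a\{r_h(s,a)+L_{\widehat{\mathcal P}_{h,s,a}}\widehat V_{h+1}\}$, and let $\widehat\pi_h(s)$ be a maximizing action (ties broken arbitrarily). **Dual variable.** For $P\in\Delta(\mathcal S)$ and $V:\mathcal S\to[0,H]$ let $\lambda^*(P,V)$ be the minimizer over $\lambda\in[0,H/\rho]$ of $\lambda\rho+\lambda\log\mathbb E_{s'\sim P}[e^{-V(s')/\lambda}]$ (with value $-\min_{\operatorname{supp}P}V$ at $\lambda=0$). For $\lambda\in(0,1)$ put $$N_{\rm KL}(\lambda)=\frac{2e^{3H/\lambda}H^5|\mathcal S||\mathcal A|}{\rho^2\epsilon^2}\log\frac{8H|\mathcal S||\mathcal A|}{\lambda\delta}.$$ Let $\underline\lambda$ be the minimum over all $(h,s,a)$ of $\lambda^*/2$ if $\lambda^*:=\lambda^*(P^o_{h,s,a},V^*_{h+1})\in(0,1)$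 and of $1/2$ otherwise; it depends only on $M$ and $\rho$. **Theorem.** Let $\rho>0$ and $\delta\in(0,1)$. 1. There is $N_0$, depending on $M,\rho,\delta$ but not on $\epsilon$, such that for all $\epsilon\in(0,H)$ and all $N\ge N_0$ with $N_{\rm total}\ge N_{\rm KL}(\underline\lambda)$, with probability at least $1-\delta$: $\|V^*-V^{\widehat\pi}\|_\infty\le\epsilon$ (for every tie-breaking). 2. For all $\lambda\in(0,1)$, all $\epsilon\in(0,H)$ and all $N$ with $N_{\rm total}\ge N_{\rm KL}(\lambda)$ (no further lower bound on $N$), the probability is at most $\delta$ that $\|V^*-V^{\widehat\pi}\|_\infty>\epsilon$ for some tie-breaking while at every $(h,s,a)$ either $L_{\mathcal P_{h,s,a}}\widehat V_{h+1}=L_{\widehat{\mathcal P}_{h,s,a}}\widehat V_{h+1}$ or both $\lambda^*(P^o_{h,s,a},\widehat V_{h+1})\ge\lambda$ and $\lambda^*(\widehat P^o_{h,s,a},\widehat V_{h+1})\ge\lambda$. -/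

import Mathlib

open MeasureTheory ProbabilityTheory

noncomputable section

namespace RobustRL

/-! ### Kullback-Leibler balls, worst-case expectations and the dual variable -/

section KL

variable {S : Type*} [Fintype S]

/-- The Kullback-Leibler divergence `∑ q(s) log (q(s) / p(s))` of two probability vectors, equal to
`⊤` when `q` is not absolutely continuous with respect to `p` (and with `0 log 0 = 0`). -/
def klDist (q p : S → ℝ) : EReal :=
  open Classical in
  if ∀ s, p s = 0 → q s = 0 then ((∑ s, q s * Real.log (q s / p s) : ℝ) : EReal) else ⊤

/-- The KL ball of radius `ρ` around `p`, inside the probability simplex. -/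
def klBall (p : S → ℝ) (ρ : ℝ) : Set (S → ℝ) :=
  {q | q ∈ stdSimplex ℝ S ∧ klDist q p ≤ (ρ : EReal)}

/-- The worst-case expectation `inf {q V : q in the KL ball of radius ρ around p}`. -/
def worstCase (p : S → ℝ) (ρ : ℝ) (V : S → ℝ) : ℝ :=
  sInf ((fun q : S → ℝ => ∑ s, q s * V s) '' klBall p ρ)

/-- The dual objective `lam * ρ + lam * log (E_p exp (-V / lam))`; at `lam = 0` it takes its limit,
minus the minimum of `V` over the support of `p`. -/
def dualObjective (p : S → ℝ) (ρ : ℝ) (V : S → ℝ) (lam : ℝ) : ℝ :=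
  open Classical in
  if lam = 0 then -sInf (V '' {s | 0 < p s})
  else lam * ρ + lam * Real.log (∑ s, p s * Real.exp (-V s / lam))

/-- The optimal dual variable: the minimizer of the dual objective over `[0, B / ρ]`, for value
functions with values in `[0, B]`. (The minimizer is unique; `sInf` extracts it.) -/
def dualOptimizer (p : S → ℝ) (ρ B : ℝ) (V : S → ℝ) : ℝ :=
  sInf {lam | lam ∈ Set.Icc 0 (B / ρ) ∧
    IsMinOn (dualObjective p ρ V) (Set.Icc 0 (B / ρ)) lam}

end KL

/-! ### Finite-horizon Markov decision processes and robust values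

Time steps `1, …, H` are the elements of `Fin H`; value functions live at the times
`1, …, H + 1`, the elements of `Fin (H + 1)`. -/

/-- A finite-horizon MDP with (nominal) transition vectors `trans h s a` in the simplex and
deterministic rewards in `[0, 1]`. -/
structure MDP (S A : Type*) [Fintype S] (H : ℕ) where
  trans : Fin H → S → A → S → ℝ
  trans_mem : ∀ h s a, trans h s a ∈ stdSimplex ℝ S
  reward : Fin H → S → A → ℝ
  reward_mem : ∀ h s a, reward h s a ∈ Set.Icc (0 : ℝ) 1

/-- Deterministic non-stationary Markov policies. -/
abbrev Policy (S A : Type*) (H : ℕ) := Fin H → S → A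

section Values

variable {S A : Type*} [Fintype S] [DecidableEq S] {H : ℕ}

/-- The value at time `h` and state `s` of the policy `π` under the transition model `P`: the
expectation of `∑_{t ≥ h} r_t (s_t, π_t (s_t))` over the trajectories `(s_t)` with `s_h = s`. The
coordinates before time `h`, which play no role, are frozen at `s`, so that every trajectory from
time `h` on is counted exactly once. -/
def policyValue (r : Fin H → S → A → ℝ) (P : Fin H → S → A → S → ℝ) (π : Policy S A H)
    (h : Fin (H + 1)) (s : S) : ℝ :=
  ∑ x : Fin (H + 1) → S with ∀ t, t ≤ h → x t = s,
    (∏ t : Fin H with h ≤ t.castSucc,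
      P t (x t.castSucc) (π t (x t.castSucc)) (x t.succ)) *
    (∑ t : Fin H with h ≤ t.castSucc, r t (x t.castSucc) (π t (x t.castSucc)))

/-- The rectangular KL uncertainty set: at each `(h, s, a)` independently, any transition vector in
the KL ball around the nominal one. -/
def MDP.uncertaintySet (M : MDP S A H) (ρ : ℝ) : Set (Fin H → S → A → S → ℝ) :=
  {Q | ∀ h s a, Q h s a ∈ klBall (M.trans h s a) ρ}

/-- The robust value function of a policy: the infimum of its values over the uncertainty set. -/
def MDP.robustValue (M : MDP S A H) (ρ : ℝ) (π : Policy S A H) (h : Fin (H + 1)) (s : S) : ℝ :=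
  ⨅ Q : M.uncertaintySet ρ, policyValue M.reward Q.1 π h s

/-- The optimal robust value function. -/
def MDP.optRobustValue (M : MDP S A H) (ρ : ℝ) (h : Fin (H + 1)) (s : S) : ℝ :=
  ⨆ π : Policy S A H, M.robustValue ρ π h s

/-- The optimal dual variable at `(h, s, a)` for the optimal robust value function at the next
time. -/
def MDP.optDual (M : MDP S A H) (ρ : ℝ) (h : Fin H) (s : S) (a : A) : ℝ :=
  dualOptimizer (M.trans h s a) ρ H (M.optRobustValue ρ h.succ)

/-- The problem-dependent parameter: the minimum over all `(h, s, a)` of `lam / 2` if the optimal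
dual variable `lam` lies in `(0, 1)`, and of `1 / 2` otherwise. -/
def MDP.dualLowerBound (M : MDP S A H) (ρ : ℝ) : ℝ :=
  ⨅ i : Fin H × S × A,
    if 0 < M.optDual ρ i.1 i.2.1 i.2.2 ∧ M.optDual ρ i.1 i.2.1 i.2.2 < 1
    then M.optDual ρ i.1 i.2.1 i.2.2 / 2 else 1 / 2

/-! ### The algorithm -/

/-- A data set of `N` sampled next states for each time, state and action. -/
abbrev Dataset (S A : Type*) (H N : ℕ) := Fin H → S → A → Fin N → S

/-- The maximum likelihood estimate of the transition vectors: relative frequencies. -/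
def empirical {N : ℕ} (D : Dataset S A H N) (h : Fin H) (s : S) (a : A) (s' : S) : ℝ :=
  (Finset.card {i : Fin N | D h s a i = s'} : ℝ) / N

/-- The value functions computed by the algorithm, by backward recursion from `0` at time `H + 1`
with the empirical KL uncertainty sets. -/
def rpvlValue {N : ℕ} (r : Fin H → S → A → ℝ) (ρ : ℝ) (D : Dataset S A H N) :
    Fin (H + 1) → S → ℝ :=
  Fin.reverseInduction (motive := fun _ => S → ℝ) (fun _ => 0)
    (fun h V s => ⨆ a : A, (r h s a + worstCase (empirical D h s a) ρ V))

/-- `π` is an output of the algorithm on the data `D`: at each `(h, s)` it chooses a maximizing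
action, with ties broken in any way. -/
def IsRPVLOutput {N : ℕ} (r : Fin H → S → A → ℝ) (ρ : ℝ) (D : Dataset S A H N)
    (π : Policy S A H) : Prop :=
  ∀ h s a,
    r h s a + worstCase (empirical D h s a) ρ (rpvlValue r ρ D h.succ) ≤
      r h s (π h s) + worstCase (empirical D h s (π h s)) ρ (rpvlValue r ρ D h.succ)

/-- On the data `D` the optimal dual variables are bounded below by `lam`: at every `(h, s, a)`,
with `V` the value function of the algorithm at the next time, either the worst-case expectations of
`V` for the nominal and for the empirical transition vector agree, or both optimal dual variables
are at least `lam`. -/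
def MDP.DualsBoundedBelow {N : ℕ} (M : MDP S A H) (ρ lam : ℝ) (D : Dataset S A H N) : Prop :=
  ∀ h s a,
    worstCase (M.trans h s a) ρ (rpvlValue M.reward ρ D h.succ) =
        worstCase (empirical D h s a) ρ (rpvlValue M.reward ρ D h.succ) ∨
      (lam ≤ dualOptimizer (M.trans h s a) ρ H (rpvlValue M.reward ρ D h.succ) ∧
        lam ≤ dualOptimizer (empirical D h s a) ρ H (rpvlValue M.reward ρ D h.succ))

/-- The random data set `X` comes from the generative model of `M`: all samples are independent,
and those at `(h, s, a)` have the law `M.trans h s a`. -/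
structure IsGenerativeSample {N : ℕ} {Ω : Type*} [MeasurableSpace Ω] [MeasurableSpace S]
    (M : MDP S A H) (μ : Measure Ω) (X : Ω → Dataset S A H N) : Prop where
  measurable : ∀ h s a i, Measurable fun ω => X ω h s a i
  indep : iIndepFun (fun (j : Fin H × S × A × Fin N) ω => X ω j.1 j.2.1 j.2.2.1 j.2.2.2) μ
  law : ∀ h s a i s', μ.real {ω | X ω h s a i = s'} = M.trans h s a s'

/-- The sample size `N_KL` (with `nS` states and `nA` actions). -/
def sampleSizeKL (nS nA H : ℕ) (ρ ε δ lam : ℝ) : ℝ :=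
  2 * Real.exp (3 * H / lam) * (H : ℝ) ^ 5 * nS * nA / (ρ ^ 2 * ε ^ 2) *
    Real.log (8 * H * nS * nA / (lam * δ))

end Values

end RobustRL

end

/-!
By rectangularity the robust values satisfy Bellman equations, so the suboptimality of the output
policy is at most `2 H` or `2 H ^ 2` times the one-step error, the difference between the worst-case
expectations of a value function `V` for the nominal vector `p` and for the empirical vector `q`;
here `V` is the value computed by the algorithm in the first case and the optimal robust value in
the second. By KL duality the worst-case expectation is minus the minimum over `lam` of
`lam * ρ + lam * log (E_p exp (-V / lam))`, and `exp (-V / lam)` is monotone in `V`. So if the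
distribution functions of `V` under `p` and `q` differ by at most `η` and both optimal dual
variables are at least `lam`, the one-step error is at most `H / ρ * exp (H / lam) * η`. The
distribution functions are controlled by Hoeffding's inequality and a union bound, also for the
value computed by the algorithm, as it depends only on samples independent of those behind `q`.

At the optimal robust value no lower bound on the dual variables need be assumed. If the nominal
optimal dual variable is positive, it stays away from `0` under small perturbations. If it is `0`,
the worst-case expectation is the minimum of `V` on the support of `p`, and a direct comparison with
the mass of the minimizers bounds the error. How small the perturbation must be depends only on the
MDP and on `ρ`, whence the threshold on the sample size.
-/

noncomputable section

namespace RobustRL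

section KL

variable {S : Type*} [Fintype S] {p q V : S → ℝ} {ρ B c lam : ℝ}

/-- The relative entropy (Kullback-Leibler divergence) of probability vectors as a real number. Its
junk value is never met: it is used only where `q` is absolutely continuous with respect to `p`. -/
def relEntropy (q p : S → ℝ) : ℝ := ∑ s, q s * Real.log (q s / p s)

/-- The exponential moment of `-V / lam` under `p`. Centring `V` at `c` only rescales it; the centre
is chosen so that the moment stays bounded as `lam` tends to `0`. -/
def expMoment (p V : S → ℝ) (c lam : ℝ) : ℝ := ∑ s, p s * Real.exp (-(V s - c) / lam)

/-- The Gibbs distribution obtained from `p` by the exponential tilt `exp (-V / lam)`. -/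
def tilted (p V : S → ℝ) (lam : ℝ) (s : S) : ℝ :=
  p s * Real.exp (-V s / lam) / expMoment p V 0 lam

/-- The minimum of `V` over the support of `p`, the limit of the negated dual objective at `0`. -/
def suppMin (p V : S → ℝ) : ℝ := sInf (V '' {s | 0 < p s})

/-- The distribution function of `V` under `p`. -/
def sublevelProb (p V : S → ℝ) (c : ℝ) : ℝ := ∑ s with V s ≤ c, p s

theorem mem_klBall_iff :
    q ∈ klBall p ρ ↔ q ∈ stdSimplex ℝ S ∧ (∀ s, p s = 0 → q s = 0) ∧ relEntropy q p ≤ ρ := by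
  by_cases h : ∀ s, p s = 0 → q s = 0
  · simp only [klBall, klDist, if_pos h, Set.mem_ofPred_eq, EReal.coe_le_coe_iff, relEntropy]
    tauto
  · simp only [klBall, klDist, if_neg h, Set.mem_ofPred_eq, top_le_iff, EReal.coe_ne_top]
    tauto

theorem relEntropy_self (p : S → ℝ) : relEntropy p p = 0 :=
  Finset.sum_eq_zero fun s _ => by by_cases h : p s = 0 <;> simp [h]

theorem relEntropy_nonneg (hp : p ∈ stdSimplex ℝ S) (hq : q ∈ stdSimplex ℝ S)
    (hqp : ∀ s, p s = 0 → q s = 0) : 0 ≤ relEntropy q p := by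
  calc (0 : ℝ) = ∑ s, (q s - p s) := by rw [Finset.sum_sub_distrib, hq.2, hp.2, sub_self]
    _ ≤ relEntropy q p := Finset.sum_le_sum fun s _ => ?_
  rcases (hq.1 s).eq_or_lt with h0 | h0
  · simp [← h0, hp.1 s]
  · have hps : 0 < p s := (hp.1 s).lt_of_ne fun h => h0.ne' (hqp s h.symm)
    calc q s - p s = q s * (1 - (q s / p s)⁻¹) := by field_simp
      _ ≤ q s * Real.log (q s / p s) :=
        mul_le_mul_of_nonneg_left (Real.one_sub_inv_le_log_of_pos (div_pos h0 hps)) h0.le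

theorem self_mem_klBall (hp : p ∈ stdSimplex ℝ S) (hρ : 0 ≤ ρ) : p ∈ klBall p ρ :=
  mem_klBall_iff.2 ⟨hp, fun _ h => h, (relEntropy_self p).trans_le hρ⟩

theorem exists_pos_of_mem_stdSimplex (hp : p ∈ stdSimplex ℝ S) : ∃ s, 0 < p s := by
  by_contra! h
  linarith [hp.2, Finset.sum_nonpos fun s (_ : s ∈ Finset.univ) => h s]

theorem le_sum_mul (hq : q ∈ stdSimplex ℝ S) (h : ∀ s, 0 < q s → c ≤ V s) :
    c ≤ ∑ s, q s * V s := by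
  calc c = ∑ s, q s * c := by rw [← Finset.sum_mul, hq.2, one_mul]
    _ ≤ ∑ s, q s * V s := Finset.sum_le_sum fun s _ => by
      rcases (hq.1 s).eq_or_lt with h0 | h0
      · simp [← h0]
      · exact mul_le_mul_of_nonneg_left (h s h0) h0.le

theorem sum_mul_le (hq : q ∈ stdSimplex ℝ S) (h : ∀ s, V s ≤ c) : ∑ s, q s * V s ≤ c := by
  calc ∑ s, q s * V s ≤ ∑ s, q s * c :=
        Finset.sum_le_sum fun s _ => mul_le_mul_of_nonneg_left (h s) (hq.1 s)
    _ = c := by rw [← Finset.sum_mul, hq.2, one_mul]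

theorem exists_eq_suppMin (hp : p ∈ stdSimplex ℝ S) (V : S → ℝ) :
    ∃ s, 0 < p s ∧ V s = suppMin p V := by
  obtain ⟨s, hs⟩ := exists_pos_of_mem_stdSimplex hp
  have hne : (V '' {s | 0 < p s}).Nonempty := ⟨_, s, hs, rfl⟩
  obtain ⟨t, ht, h⟩ := hne.csInf_mem (Set.toFinite _)
  exact ⟨t, ht, h⟩

theorem suppMin_le {S : Type*} [Finite S] {p : S → ℝ} (V : S → ℝ) {s : S} (hs : 0 < p s) :
    suppMin p V ≤ V s :=
  csInf_le (Set.toFinite _).bddBelow ⟨s, hs, rfl⟩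

theorem sublevelProb_suppMin_pos (hp : p ∈ stdSimplex ℝ S) (V : S → ℝ) :
    0 < sublevelProb p V (suppMin p V) := by
  obtain ⟨s, hs, h⟩ := exists_eq_suppMin hp V
  exact Finset.sum_pos' (fun s _ => hp.1 s) ⟨s, by simp [h], hs⟩

theorem expMoment_pos (hp : p ∈ stdSimplex ℝ S) (V : S → ℝ) (c lam : ℝ) :
    0 < expMoment p V c lam := by
  obtain ⟨s, hs⟩ := exists_pos_of_mem_stdSimplex hp
  exact Finset.sum_pos' (fun s _ => mul_nonneg (hp.1 s) (Real.exp_pos _).le)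
    ⟨s, Finset.mem_univ _, mul_pos hs (Real.exp_pos _)⟩

theorem dualObjective_zero (p : S → ℝ) (ρ : ℝ) (V : S → ℝ) :
    dualObjective p ρ V 0 = -suppMin p V := by
  simp [dualObjective, suppMin]

theorem dualObjective_eq (hp : p ∈ stdSimplex ℝ S) (ρ : ℝ) (V : S → ℝ) (c : ℝ) (hlam : 0 < lam) :
    dualObjective p ρ V lam = lam * ρ - c + lam * Real.log (expMoment p V c lam) := by
  have h : ∑ s, p s * Real.exp (-V s / lam) = Real.exp (-c / lam) * expMoment p V c lam := by
    rw [expMoment, Finset.mul_sum]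
    refine Finset.sum_congr rfl fun s _ => ?_
    rw [mul_left_comm, ← Real.exp_add]
    congr 2
    ring
  rw [dualObjective, if_neg hlam.ne', h, Real.log_mul (Real.exp_pos _).ne'
    (expMoment_pos hp V c lam).ne', Real.log_exp]
  field_simp
  ring

theorem dualObjective_le_neg_iff (hp : p ∈ stdSimplex ℝ S) (hlam : 0 < lam) :
    dualObjective p ρ V lam ≤ -c ↔ expMoment p V c lam ≤ Real.exp (-ρ) := by
  rw [dualObjective_eq hp ρ V c hlam, ← Real.log_le_iff_le_exp (expMoment_pos hp V c lam)]
  constructor <;> intro h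
  · nlinarith
  · nlinarith

theorem neg_le_dualObjective_iff (hp : p ∈ stdSimplex ℝ S) (hlam : 0 < lam) :
    -c ≤ dualObjective p ρ V lam ↔ Real.exp (-ρ) ≤ expMoment p V c lam := by
  rw [dualObjective_eq hp ρ V c hlam, ← Real.le_log_iff_exp_le (expMoment_pos hp V c lam)]
  constructor <;> intro h
  · nlinarith
  · nlinarith

theorem tilted_mem_stdSimplex (hp : p ∈ stdSimplex ℝ S) (V : S → ℝ) (lam : ℝ) :
    tilted p V lam ∈ stdSimplex ℝ S := by
  have hZ := expMoment_pos hp V 0 lam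
  refine ⟨fun s => div_nonneg (mul_nonneg (hp.1 s) (Real.exp_pos _).le) hZ.le, ?_⟩
  simp only [tilted, ← Finset.sum_div]
  rw [div_eq_one_iff_eq hZ.ne']
  simp only [expMoment, sub_zero]

theorem tilted_eq_zero_iff (hp : p ∈ stdSimplex ℝ S) {s : S} :
    tilted p V lam s = 0 ↔ p s = 0 := by
  simp [tilted, (expMoment_pos hp V 0 lam).ne']

theorem lagrangian_eq (hp : p ∈ stdSimplex ℝ S) (hq : q ∈ stdSimplex ℝ S)
    (hqp : ∀ s, p s = 0 → q s = 0) (ρ : ℝ) (V : S → ℝ) (hlam : 0 < lam) :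
    ∑ s, q s * V s + lam * (relEntropy q p - ρ) =
      -dualObjective p ρ V lam + lam * relEntropy q (tilted p V lam) := by
  have hZ := expMoment_pos hp V 0 lam
  have hterm : ∀ s, q s * Real.log (q s / tilted p V lam s) =
      q s * Real.log (q s / p s) + q s * V s / lam +
        q s * Real.log (expMoment p V 0 lam) := by
    intro s
    by_cases h0 : q s = 0
    · simp [h0]
    have hps : p s ≠ 0 := fun h => h0 (hqp s h)
    have hps' : p s * Real.exp (-V s / lam) ≠ 0 := mul_ne_zero hps (Real.exp_pos _).ne'
    rw [tilted, Real.log_div h0 (div_ne_zero hps' hZ.ne'), Real.log_div hps' hZ.ne',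
      Real.log_mul hps (Real.exp_pos _).ne', Real.log_exp, Real.log_div h0 hps]
    ring
  have hsum : relEntropy q (tilted p V lam) =
      relEntropy q p + (∑ s, q s * V s) / lam + Real.log (expMoment p V 0 lam) := by
    rw [relEntropy, Finset.sum_congr rfl fun s _ => hterm s, Finset.sum_add_distrib,
      Finset.sum_add_distrib, ← Finset.sum_div, ← Finset.sum_mul, hq.2, one_mul, relEntropy]
  rw [hsum, dualObjective_eq hp ρ V 0 hlam]
  field_simp
  ring

theorem neg_dualObjective_le_lagrangian (hp : p ∈ stdSimplex ℝ S) (hq : q ∈ stdSimplex ℝ S)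
    (hqp : ∀ s, p s = 0 → q s = 0) (ρ : ℝ) (V : S → ℝ) (hlam : 0 ≤ lam) :
    -dualObjective p ρ V lam ≤ ∑ s, q s * V s + lam * (relEntropy q p - ρ) := by
  rcases hlam.eq_or_lt with rfl | hlam
  · rw [dualObjective_zero, neg_neg, zero_mul, add_zero]
    exact le_sum_mul hq fun s hs => suppMin_le V ((hp.1 s).lt_of_ne' fun h => hs.ne' (hqp s h))
  · rw [lagrangian_eq hp hq hqp ρ V hlam, le_add_iff_nonneg_right]
    exact mul_nonneg hlam.le (relEntropy_nonneg (tilted_mem_stdSimplex hp V lam) hq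
      fun s h => hqp s ((tilted_eq_zero_iff hp).1 h))

theorem exists_lagrangian_eq_neg_dualObjective (hp : p ∈ stdSimplex ℝ S) (ρ : ℝ) (V : S → ℝ)
    (hlam : 0 ≤ lam) :
    ∃ q ∈ stdSimplex ℝ S, (∀ s, p s = 0 → q s = 0) ∧
      ∑ s, q s * V s + lam * (relEntropy q p - ρ) = -dualObjective p ρ V lam := by
  classical
  rcases hlam.eq_or_lt with rfl | hlam
  · obtain ⟨t, ht, hVt⟩ := exists_eq_suppMin hp V
    refine ⟨Pi.single t 1, single_mem_stdSimplex ℝ t, fun s hs => ?_, ?_⟩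
    · exact Pi.single_eq_of_ne (by rintro rfl; exact ht.ne' hs) 1
    · simp [dualObjective_zero, ← hVt, Pi.single_apply]
  · have hqp : ∀ s, p s = 0 → tilted p V lam s = 0 := fun s => (tilted_eq_zero_iff hp).2
    refine ⟨tilted p V lam, tilted_mem_stdSimplex hp V lam, hqp, ?_⟩
    rw [lagrangian_eq hp (tilted_mem_stdSimplex hp V lam) hqp ρ V hlam, relEntropy_self, mul_zero,
      add_zero]

theorem convexOn_dualObjective (hp : p ∈ stdSimplex ℝ S) (ρ : ℝ) (V : S → ℝ) :
    ConvexOn ℝ (Set.Ici 0) (dualObjective p ρ V) := by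
  refine ⟨convex_Ici 0, fun x hx y hy a b ha hb hab => ?_⟩
  obtain ⟨q, hq, hqp, h⟩ := exists_lagrangian_eq_neg_dualObjective hp ρ V
    (convex_Ici (0 : ℝ) hx hy ha hb hab)
  have hx' := mul_le_mul_of_nonneg_left (neg_dualObjective_le_lagrangian hp hq hqp ρ V hx) ha
  have hy' := mul_le_mul_of_nonneg_left (neg_dualObjective_le_lagrangian hp hq hqp ρ V hy) hb
  simp only [smul_eq_mul] at h ⊢
  linear_combination hx' + hy' + h + (∑ s, q s * V s) * hab

theorem neg_dualObjective_le_sum (hp : p ∈ stdSimplex ℝ S) (hq : q ∈ klBall p ρ) (V : S → ℝ)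
    (hlam : 0 ≤ lam) : -dualObjective p ρ V lam ≤ ∑ s, q s * V s := by
  obtain ⟨hq, hqp, hent⟩ := mem_klBall_iff.1 hq
  linarith [neg_dualObjective_le_lagrangian hp hq hqp ρ V hlam,
    mul_nonneg hlam (sub_nonneg.2 hent)]

open Filter Topology in
theorem tendsto_expMoment_suppMin (hp : p ∈ stdSimplex ℝ S) (V : S → ℝ) :
    Tendsto (expMoment p V (suppMin p V)) (𝓝[>] 0) (𝓝 (sublevelProb p V (suppMin p V))) := by
  have hterm : ∀ s, Tendsto (fun lam : ℝ => p s * Real.exp (-(V s - suppMin p V) / lam)) (𝓝[>] 0)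
      (𝓝 (if V s ≤ suppMin p V then p s else 0)) := by
    intro s
    rcases (hp.1 s).eq_or_lt with h0 | h0
    · simp [← h0]
    rcases (suppMin_le V h0).eq_or_lt with h1 | h1
    · simp [← h1]
    · rw [if_neg (not_le.2 h1)]
      have h2 : Tendsto (fun lam : ℝ => -(V s - suppMin p V) / lam) (𝓝[>] 0) atBot := by
        simp only [div_eq_mul_inv]
        exact tendsto_inv_nhdsGT_zero.const_mul_atTop_of_neg (by linarith)
      simpa using (Real.tendsto_exp_atBot.comp h2).const_mul (p s)
  have := tendsto_finsetSum Finset.univ fun s _ => hterm s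
  rwa [← Finset.sum_filter] at this

theorem differentiableAt_dualObjective (hp : p ∈ stdSimplex ℝ S) (ρ : ℝ) (V : S → ℝ)
    (hlam : 0 < lam) : DifferentiableAt ℝ (dualObjective p ρ V) lam := by
  have h : DifferentiableAt ℝ
      (fun lam => lam * ρ - 0 + lam * Real.log (expMoment p V 0 lam)) lam := by
    have hZ : ∑ s, p s * Real.exp (-(V s - 0) / lam) ≠ 0 := (expMoment_pos hp V 0 lam).ne'
    have h0 := hlam.ne'
    unfold expMoment
    fun_prop (disch := assumption)
  refine h.congr_of_eventuallyEq ?_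
  filter_upwards [Ioi_mem_nhds hlam] with x hx using dualObjective_eq hp ρ V 0 hx

open Filter Topology in
theorem continuousOn_dualObjective (hp : p ∈ stdSimplex ℝ S) (ρ : ℝ) (V : S → ℝ) :
    ContinuousOn (dualObjective p ρ V) (Set.Ici 0) := by
  intro lam hlam
  rcases (Set.mem_Ici.1 hlam).eq_or_lt with rfl | hlam
  · rw [← continuousWithinAt_Ioi_iff_Ici, ContinuousWithinAt, dualObjective_zero]
    have hid : Tendsto (fun lam : ℝ => lam) (𝓝[>] 0) (𝓝 0) := nhdsWithin_le_nhds
    have hlim := ((hid.mul_const ρ).sub_const (suppMin p V)).add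
      (hid.mul ((tendsto_expMoment_suppMin hp V).log (sublevelProb_suppMin_pos hp V).ne'))
    rw [zero_mul, zero_mul, zero_sub, add_zero] at hlim
    refine hlim.congr' ?_
    filter_upwards [self_mem_nhdsWithin] with x hx using (dualObjective_eq hp ρ V _ hx).symm
  · exact (differentiableAt_dualObjective hp ρ V hlam).continuousAt.continuousWithinAt

theorem exp_neg_le_sublevelProb (hp : p ∈ stdSimplex ℝ S)
    (h : IsMinOn (dualObjective p ρ V) (Set.Ici 0) 0) :
    Real.exp (-ρ) ≤ sublevelProb p V (suppMin p V) := by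
  refine ge_of_tendsto (tendsto_expMoment_suppMin hp V) ?_
  filter_upwards [self_mem_nhdsWithin] with x hx
  rw [← neg_le_dualObjective_iff hp hx, ← dualObjective_zero]
  exact h (Set.mem_Ioi.1 hx).le

/-- The conditional distribution of `p` given that `V` takes its minimal value on the support. -/
def condArgmin (p V : S → ℝ) (s : S) : ℝ :=
  if V s ≤ suppMin p V then p s / sublevelProb p V (suppMin p V) else 0

theorem condArgmin_mem_stdSimplex (hp : p ∈ stdSimplex ℝ S) (V : S → ℝ) :
    condArgmin p V ∈ stdSimplex ℝ S := by
  have hw := sublevelProb_suppMin_pos hp V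
  refine ⟨fun s => ?_, ?_⟩
  · unfold condArgmin
    split_ifs
    exacts [div_nonneg (hp.1 s) hw.le, le_rfl]
  · simp only [condArgmin, ← Finset.sum_filter, ← Finset.sum_div]
    exact div_self hw.ne'

theorem relEntropy_condArgmin (hp : p ∈ stdSimplex ℝ S) (V : S → ℝ) :
    relEntropy (condArgmin p V) p = -Real.log (sublevelProb p V (suppMin p V)) := by
  have hw := sublevelProb_suppMin_pos hp V
  have hterm : ∀ s, condArgmin p V s * Real.log (condArgmin p V s / p s) =
      condArgmin p V s * -Real.log (sublevelProb p V (suppMin p V)) := by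
    intro s
    by_cases h0 : condArgmin p V s = 0
    · simp [h0]
    have hs : V s ≤ suppMin p V ∧ p s ≠ 0 := by
      simpa [condArgmin, hw.ne', imp_iff_not_or] using h0
    rw [← Real.log_inv, condArgmin, if_pos hs.1, div_right_comm, div_self hs.2, one_div]
  rw [relEntropy, Finset.sum_congr rfl fun s _ => hterm s, ← Finset.sum_mul,
    (condArgmin_mem_stdSimplex hp V).2, one_mul]

theorem sum_condArgmin_mul (hp : p ∈ stdSimplex ℝ S) (V : S → ℝ) :
    ∑ s, condArgmin p V s * V s = suppMin p V := by
  have hterm : ∀ s, condArgmin p V s * V s = condArgmin p V s * suppMin p V := by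
    intro s
    by_cases h0 : condArgmin p V s = 0
    · simp [h0]
    have hs : V s ≤ suppMin p V ∧ p s ≠ 0 := by
      simpa [condArgmin, (sublevelProb_suppMin_pos hp V).ne', imp_iff_not_or] using h0
    rw [hs.1.antisymm (suppMin_le V ((hp.1 s).lt_of_ne' hs.2))]
  rw [Finset.sum_congr rfl fun s _ => hterm s, ← Finset.sum_mul,
    (condArgmin_mem_stdSimplex hp V).2, one_mul]

theorem condArgmin_mem_klBall (hp : p ∈ stdSimplex ℝ S)
    (h : Real.exp (-ρ) ≤ sublevelProb p V (suppMin p V)) : condArgmin p V ∈ klBall p ρ := by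
  refine mem_klBall_iff.2 ⟨condArgmin_mem_stdSimplex hp V, fun s hs => by simp [condArgmin, hs], ?_⟩
  rw [relEntropy_condArgmin hp V]
  linarith [(Real.le_log_iff_exp_le (sublevelProb_suppMin_pos hp V)).2 h]

/- At an interior minimizer `lam` of the dual objective, the optimal tilt has relative entropy
exactly `ρ`: the Lagrangian at this fixed tilt is affine in the multiplier and touches the negated
dual objective, whose derivative vanishes, from above. -/
theorem exists_mem_klBall_sum_eq_neg_dualObjective (hp : p ∈ stdSimplex ℝ S) (hlam : 0 ≤ lam)
    (h : IsMinOn (dualObjective p ρ V) (Set.Ici 0) lam) :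
    ∃ q ∈ klBall p ρ, ∑ s, q s * V s = -dualObjective p ρ V lam := by
  rcases hlam.eq_or_lt with rfl | hlam
  · rw [dualObjective_zero, neg_neg]
    exact ⟨_, condArgmin_mem_klBall hp (exp_neg_le_sublevelProb hp h), sum_condArgmin_mul hp V⟩
  obtain ⟨q, hq, hqp, htouch⟩ := exists_lagrangian_eq_neg_dualObjective hp ρ V hlam.le
  have hderiv : HasDerivAt (dualObjective p ρ V) 0 lam := by
    have hmin : IsLocalMin (dualObjective p ρ V) lam := h.isLocalMin (Ici_mem_nhds hlam)
    simpa only [hmin.deriv_eq_zero] using (differentiableAt_dualObjective hp ρ V hlam).hasDerivAt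
  have hgap : HasDerivAt (fun x => ∑ s, q s * V s + x * (relEntropy q p - ρ) +
      dualObjective p ρ V x) (relEntropy q p - ρ) lam := by
    simpa using (((hasDerivAt_id lam).mul_const (relEntropy q p - ρ)).const_add _).fun_add hderiv
  have hent : relEntropy q p - ρ = 0 := by
    refine IsLocalMin.hasDerivAt_eq_zero ?_ hgap
    filter_upwards [Ioi_mem_nhds hlam] with x hx
    linarith [neg_dualObjective_le_lagrangian hp hq hqp ρ V (Set.mem_Ioi.1 hx).le]
  refine ⟨q, mem_klBall_iff.2 ⟨hq, hqp, (sub_eq_zero.1 hent).le⟩, ?_⟩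
  rw [← htouch, hent, mul_zero, add_zero]

theorem worstCase_eq_neg_dualObjective (hp : p ∈ stdSimplex ℝ S) (hlam : 0 ≤ lam)
    (h : IsMinOn (dualObjective p ρ V) (Set.Ici 0) lam) :
    worstCase p ρ V = -dualObjective p ρ V lam := by
  obtain ⟨q, hq, he⟩ := exists_mem_klBall_sum_eq_neg_dualObjective hp hlam h
  refine IsLeast.csInf_eq ⟨⟨q, hq, he⟩, ?_⟩
  rintro _ ⟨q', hq', rfl⟩
  exact neg_dualObjective_le_sum hp hq' V hlam

theorem neg_dualObjective_le_worstCase (hp : p ∈ stdSimplex ℝ S) (hρ : 0 ≤ ρ) (V : S → ℝ)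
    (hlam : 0 ≤ lam) : -dualObjective p ρ V lam ≤ worstCase p ρ V := by
  refine le_csInf ⟨_, p, self_mem_klBall hp hρ, rfl⟩ ?_
  rintro _ ⟨q', hq', rfl⟩
  exact neg_dualObjective_le_sum hp hq' V hlam

theorem worstCase_le_sum (hp : p ∈ stdSimplex ℝ S) (hq : q ∈ klBall p ρ) (V : S → ℝ) :
    worstCase p ρ V ≤ ∑ s, q s * V s :=
  csInf_le ⟨-dualObjective p ρ V 0, by
    rintro _ ⟨q', hq', rfl⟩
    exact neg_dualObjective_le_sum hp hq' V le_rfl⟩ ⟨q, hq, rfl⟩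

theorem suppMin_le_worstCase (hp : p ∈ stdSimplex ℝ S) (hρ : 0 ≤ ρ) (V : S → ℝ) :
    suppMin p V ≤ worstCase p ρ V := by
  simpa only [dualObjective_zero, neg_neg] using neg_dualObjective_le_worstCase hp hρ V le_rfl

theorem worstCase_eq_suppMin (hp : p ∈ stdSimplex ℝ S) (hρ : 0 ≤ ρ)
    (h : Real.exp (-ρ) ≤ sublevelProb p V (suppMin p V)) : worstCase p ρ V = suppMin p V :=
  ((worstCase_le_sum hp (condArgmin_mem_klBall hp h) V).trans_eq
    (sum_condArgmin_mul hp V)).antisymm (suppMin_le_worstCase hp hρ V)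

theorem worstCase_mem_Icc (hp : p ∈ stdSimplex ℝ S) (hρ : 0 ≤ ρ) {b : ℝ}
    (hV : ∀ s, V s ∈ Set.Icc b B) : worstCase p ρ V ∈ Set.Icc b B := by
  refine ⟨?_, (worstCase_le_sum hp (self_mem_klBall hp hρ) V).trans
    (sum_mul_le hp fun s => (hV s).2)⟩
  obtain ⟨s, -, hs⟩ := exists_eq_suppMin hp V
  exact (hV s).1.trans (hs.le.trans (suppMin_le_worstCase hp hρ V))

theorem lipschitzWith_worstCase (hp : p ∈ stdSimplex ℝ S) (hρ : 0 ≤ ρ) :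
    LipschitzWith 1 (worstCase p ρ) := by
  refine LipschitzWith.of_le_add fun V W => ?_
  rw [← sub_le_iff_le_add]
  refine le_csInf ⟨_, p, self_mem_klBall hp hρ, rfl⟩ ?_
  rintro _ ⟨q, hq, rfl⟩
  have hdist : ∑ s, q s * (V s - W s) ≤ dist V W :=
    sum_mul_le (mem_klBall_iff.1 hq).1 fun s =>
      (le_abs_self _).trans (dist_le_pi_dist V W s)
  simp only [mul_sub, Finset.sum_sub_distrib] at hdist
  linarith [worstCase_le_sum hp hq V]

theorem worstCase_mono (hp : p ∈ stdSimplex ℝ S) (hρ : 0 ≤ ρ) : Monotone (worstCase p ρ) := by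
  intro V W hVW
  refine le_csInf ⟨_, p, self_mem_klBall hp hρ, rfl⟩ ?_
  rintro _ ⟨q, hq, rfl⟩
  exact (worstCase_le_sum hp hq V).trans (Finset.sum_le_sum fun s _ =>
    mul_le_mul_of_nonneg_left (hVW s) ((mem_klBall_iff.1 hq).1.1 s))

theorem dualObjective_nonneg_of_div_le (hp : p ∈ stdSimplex ℝ S) (hρ : 0 < ρ) (hV : ∀ s, V s ≤ B)
    (hlam : 0 < lam) (h : B / ρ ≤ lam) : 0 ≤ dualObjective p ρ V lam := by
  have hmoment : 1 ≤ expMoment p V B lam := by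
    rw [← hp.2]
    exact Finset.sum_le_sum fun s _ => le_mul_of_one_le_right (hp.1 s)
      (Real.one_le_exp (div_nonneg (by linarith [hV s]) hlam.le))
  rw [dualObjective_eq hp ρ V B hlam]
  linarith [(div_le_iff₀ hρ).1 h, mul_nonneg hlam.le (Real.log_nonneg hmoment)]

theorem nonneg_of_forall_mem_Icc (hp : p ∈ stdSimplex ℝ S) (hV : ∀ s, V s ∈ Set.Icc 0 B) :
    0 ≤ B := by
  obtain ⟨s, -⟩ := exists_pos_of_mem_stdSimplex hp
  exact (hV s).1.trans (hV s).2

theorem isMinOn_dualObjective_Ici (hp : p ∈ stdSimplex ℝ S) (hρ : 0 < ρ)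
    (hV : ∀ s, V s ∈ Set.Icc 0 B) (h : IsMinOn (dualObjective p ρ V) (Set.Icc 0 (B / ρ)) lam) :
    IsMinOn (dualObjective p ρ V) (Set.Ici 0) lam := by
  have hBρ : 0 ≤ B / ρ := div_nonneg (nonneg_of_forall_mem_Icc hp hV) hρ.le
  intro x hx
  rcases le_or_gt x (B / ρ) with hxB | hxB
  · exact h ⟨hx, hxB⟩
  calc dualObjective p ρ V lam ≤ dualObjective p ρ V 0 := h ⟨le_rfl, hBρ⟩
    _ ≤ 0 := by
      obtain ⟨s, -, hs⟩ := exists_eq_suppMin hp V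
      rw [dualObjective_zero, ← hs, neg_nonpos]
      exact (hV s).1
    _ ≤ dualObjective p ρ V x :=
      dualObjective_nonneg_of_div_le hp hρ (fun s => (hV s).2) (hBρ.trans_lt hxB) hxB.le

theorem dualOptimizer_mem (hp : p ∈ stdSimplex ℝ S) (hBρ : 0 ≤ B / ρ) (V : S → ℝ) :
    dualOptimizer p ρ B V ∈ {lam | lam ∈ Set.Icc 0 (B / ρ) ∧
      IsMinOn (dualObjective p ρ V) (Set.Icc 0 (B / ρ)) lam} := by
  have hcont : ContinuousOn (dualObjective p ρ V) (Set.Icc 0 (B / ρ)) :=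
    (continuousOn_dualObjective hp ρ V).mono Set.Icc_subset_Ici_self
  obtain ⟨x, hx, hmin⟩ := isCompact_Icc.exists_isMinOn (Set.nonempty_Icc.2 hBρ) hcont
  have hset : {lam | lam ∈ Set.Icc 0 (B / ρ) ∧
      IsMinOn (dualObjective p ρ V) (Set.Icc 0 (B / ρ)) lam} =
      Set.Icc 0 (B / ρ) ∩ dualObjective p ρ V ⁻¹' Set.Iic (dualObjective p ρ V x) := by
    ext y
    exact ⟨fun h => ⟨h.1, h.2 hx⟩, fun h => ⟨h.1, isMinOn_iff.2 fun z hz => le_trans h.2 (hmin hz)⟩⟩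
  rw [dualOptimizer]
  refine IsCompact.sInf_mem ?_ ⟨x, hx, hmin⟩
  rw [hset]
  exact isCompact_Icc.of_isClosed_subset
    (hcont.preimage_isClosed_of_isClosed isClosed_Icc isClosed_Iic) Set.inter_subset_left

theorem dualOptimizer_mem_Icc (hp : p ∈ stdSimplex ℝ S) (hρ : 0 < ρ)
    (hV : ∀ s, V s ∈ Set.Icc 0 B) :
    dualOptimizer p ρ B V ∈ Set.Icc 0 (B / ρ) :=
  (dualOptimizer_mem hp (div_nonneg (nonneg_of_forall_mem_Icc hp hV) hρ.le) V).1

theorem isMinOn_dualOptimizer (hp : p ∈ stdSimplex ℝ S) (hρ : 0 < ρ)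
    (hV : ∀ s, V s ∈ Set.Icc 0 B) :
    IsMinOn (dualObjective p ρ V) (Set.Ici 0) (dualOptimizer p ρ B V) :=
  isMinOn_dualObjective_Ici hp hρ hV
    (dualOptimizer_mem hp (div_nonneg (nonneg_of_forall_mem_Icc hp hV) hρ.le) V).2

theorem worstCase_eq_neg_dualObjective_dualOptimizer (hp : p ∈ stdSimplex ℝ S)
    (hρ : 0 < ρ) (hV : ∀ s, V s ∈ Set.Icc 0 B) :
    worstCase p ρ V = -dualObjective p ρ V (dualOptimizer p ρ B V) :=
  worstCase_eq_neg_dualObjective hp (dualOptimizer_mem_Icc hp hρ hV).1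
    (isMinOn_dualOptimizer hp hρ hV)

theorem exists_mem_klBall_sum_eq_worstCase (hp : p ∈ stdSimplex ℝ S) (hρ : 0 < ρ)
    (hV : ∀ s, V s ∈ Set.Icc 0 B) :
    ∃ q ∈ klBall p ρ, ∑ s, q s * V s = worstCase p ρ V := by
  rw [worstCase_eq_neg_dualObjective_dualOptimizer hp hρ hV]
  exact exists_mem_klBall_sum_eq_neg_dualObjective hp (dualOptimizer_mem_Icc hp hρ hV).1
    (isMinOn_dualOptimizer hp hρ hV)

end KL

section Trajectories

variable {S A : Type*} {H : ℕ}

/-- The trajectory `x` with all coordinates up to time `k` replaced by the state `s`: the encoding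
of the trajectories that start in `s` at time `k`. -/
def freezeUpTo (k : Fin (H + 1)) (s : S) (x : Fin (H + 1) → S) (t : Fin (H + 1)) : S :=
  if t ≤ k then s else x t

theorem freezeUpTo_of_le {k t : Fin (H + 1)} (ht : t ≤ k) (s : S) (x : Fin (H + 1) → S) :
    freezeUpTo k s x t = s := if_pos ht

theorem freezeUpTo_of_lt {k t : Fin (H + 1)} (ht : k < t) (s : S) (x : Fin (H + 1) → S) :
    freezeUpTo k s x t = x t := if_neg ht.not_ge

theorem freezeUpTo_eq_self {k : Fin (H + 1)} {s : S} {x : Fin (H + 1) → S}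
    (hx : ∀ t, t ≤ k → x t = s) : freezeUpTo k s x = x := by
  funext t
  unfold freezeUpTo
  split_ifs with ht
  exacts [(hx t ht).symm, rfl]

theorem freezeUpTo_freezeUpTo_of_le {j k : Fin (H + 1)} (hjk : j ≤ k) (s s' : S)
    (x : Fin (H + 1) → S) : freezeUpTo k s (freezeUpTo j s' x) = freezeUpTo k s x := by
  funext t
  rcases le_or_gt t k with ht | ht
  · rw [freezeUpTo_of_le ht, freezeUpTo_of_le ht]
  · rw [freezeUpTo_of_lt ht, freezeUpTo_of_lt ht, freezeUpTo_of_lt (hjk.trans_lt ht)]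

theorem freezeUpTo_castSucc_freezeUpTo_succ (h : Fin H) (s : S) (x : Fin (H + 1) → S) :
    freezeUpTo h.castSucc s (freezeUpTo h.succ (x h.succ) x) = freezeUpTo h.castSucc s x := by
  funext t
  rcases le_or_gt t h.castSucc with ht | ht
  · rw [freezeUpTo_of_le ht, freezeUpTo_of_le ht]
  rw [freezeUpTo_of_lt ht, freezeUpTo_of_lt ht]
  rcases (Fin.castSucc_lt_iff_succ_le.1 ht).eq_or_lt with rfl | ht
  · rw [freezeUpTo_of_le le_rfl]
  · rw [freezeUpTo_of_lt ht]

theorem filter_castSucc_le_castSucc (h : Fin H) :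
    ({t : Fin H | h.castSucc ≤ t.castSucc} : Finset (Fin H)) =
      insert h ({t : Fin H | h.succ ≤ t.castSucc} : Finset (Fin H)) := by
  ext t
  simp only [Finset.mem_filter, Finset.mem_univ, true_and, Finset.mem_insert, Fin.le_def,
    Fin.val_castSucc, Fin.val_succ, Fin.ext_iff]
  omega

theorem notMem_filter_succ_le_castSucc (h : Fin H) :
    h ∉ ({t : Fin H | h.succ ≤ t.castSucc} : Finset (Fin H)) := by
  simp [Fin.le_def]

theorem filter_last_le_castSucc :
    ({t : Fin H | Fin.last H ≤ t.castSucc} : Finset (Fin H)) = ∅ := by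
  ext t
  simp [Fin.le_def]

/-- The probability of the trajectory `x` from time `k` on. -/
def pathProb (P : Fin H → S → A → S → ℝ) (π : Policy S A H) (k : Fin (H + 1))
    (x : Fin (H + 1) → S) : ℝ :=
  ∏ t : Fin H with k ≤ t.castSucc, P t (x t.castSucc) (π t (x t.castSucc)) (x t.succ)

/-- The total reward of the trajectory `x` from time `k` on. -/
def pathReward (r : Fin H → S → A → ℝ) (π : Policy S A H) (k : Fin (H + 1))
    (x : Fin (H + 1) → S) : ℝ :=
  ∑ t : Fin H with k ≤ t.castSucc, r t (x t.castSucc) (π t (x t.castSucc))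

theorem pathProb_last (P : Fin H → S → A → S → ℝ) (π : Policy S A H) (x : Fin (H + 1) → S) :
    pathProb P π (Fin.last H) x = 1 := by
  rw [pathProb, filter_last_le_castSucc, Finset.prod_empty]

theorem pathReward_last (r : Fin H → S → A → ℝ) (π : Policy S A H) (x : Fin (H + 1) → S) :
    pathReward r π (Fin.last H) x = 0 := by
  rw [pathReward, filter_last_le_castSucc, Finset.sum_empty]

theorem pathProb_castSucc_freezeUpTo (P : Fin H → S → A → S → ℝ) (π : Policy S A H) (h : Fin H)
    (s : S) (x : Fin (H + 1) → S) :
    pathProb P π h.castSucc (freezeUpTo h.castSucc s x) =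
      P h s (π h s) (x h.succ) * pathProb P π h.succ x := by
  rw [pathProb, filter_castSucc_le_castSucc, Finset.prod_insert (notMem_filter_succ_le_castSucc h),
    freezeUpTo_of_le le_rfl, freezeUpTo_of_lt Fin.castSucc_lt_succ]
  congr 1
  refine Finset.prod_congr rfl fun t ht => ?_
  have ht : h.castSucc < t.castSucc :=
    Fin.castSucc_lt_succ.trans_le (Finset.mem_filter.1 ht).2
  rw [freezeUpTo_of_lt ht, freezeUpTo_of_lt (ht.trans Fin.castSucc_lt_succ)]

theorem pathReward_castSucc_freezeUpTo (r : Fin H → S → A → ℝ) (π : Policy S A H) (h : Fin H)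
    (s : S) (x : Fin (H + 1) → S) :
    pathReward r π h.castSucc (freezeUpTo h.castSucc s x) =
      r h s (π h s) + pathReward r π h.succ x := by
  rw [pathReward, filter_castSucc_le_castSucc, Finset.sum_insert (notMem_filter_succ_le_castSucc h),
    freezeUpTo_of_le le_rfl]
  congr 1
  refine Finset.sum_congr rfl fun t ht => ?_
  rw [freezeUpTo_of_lt (Fin.castSucc_lt_succ.trans_le (Finset.mem_filter.1 ht).2)]

variable [Fintype S] [DecidableEq S]

/-- The trajectories from time `k` on that start in the state `s`. -/
def trajectories (k : Fin (H + 1)) (s : S) : Finset (Fin (H + 1) → S) :=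
  {x | ∀ t, t ≤ k → x t = s}

theorem mem_trajectories {k : Fin (H + 1)} {s : S} {x : Fin (H + 1) → S} :
    x ∈ trajectories k s ↔ ∀ t, t ≤ k → x t = s := by
  simp [trajectories]

theorem freezeUpTo_mem_trajectories (k : Fin (H + 1)) (s : S) (x : Fin (H + 1) → S) :
    freezeUpTo k s x ∈ trajectories k s :=
  mem_trajectories.2 fun _ ht => freezeUpTo_of_le ht s x

theorem trajectories_last (s : S) : trajectories (Fin.last H) s = {fun _ => s} := by
  ext x
  simp [mem_trajectories, Fin.le_last, funext_iff]

theorem sum_trajectories_castSucc (h : Fin H) (s : S) (f : (Fin (H + 1) → S) → ℝ) :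
    ∑ x ∈ trajectories h.castSucc s, f x =
      ∑ s', ∑ y ∈ trajectories h.succ s', f (freezeUpTo h.castSucc s y) := by
  rw [← Finset.sum_fiberwise _ (fun x : Fin (H + 1) → S => x h.succ)]
  refine Finset.sum_congr rfl fun s' _ => ?_
  have hinv : ∀ x ∈ (trajectories h.castSucc s).filter (fun x => x h.succ = s'),
      freezeUpTo h.castSucc s (freezeUpTo h.succ s' x) = x := by
    intro x hx
    obtain ⟨hxs, rfl⟩ := Finset.mem_filter.1 hx
    rw [freezeUpTo_castSucc_freezeUpTo_succ, freezeUpTo_eq_self (mem_trajectories.1 hxs)]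
  refine Finset.sum_bij' (fun x _ => freezeUpTo h.succ s' x)
    (fun y _ => freezeUpTo h.castSucc s y) (fun x _ => freezeUpTo_mem_trajectories _ _ x)
    (fun y hy => Finset.mem_filter.2 ⟨freezeUpTo_mem_trajectories _ _ y, ?_⟩) hinv
    (fun y hy => ?_) (fun x hx => congrArg f (hinv x hx).symm)
  · rw [freezeUpTo_of_lt Fin.castSucc_lt_succ, mem_trajectories.1 hy _ le_rfl]
  · rw [freezeUpTo_freezeUpTo_of_le Fin.castSucc_lt_succ.le,
      freezeUpTo_eq_self (mem_trajectories.1 hy)]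

theorem sum_pathProb {P : Fin H → S → A → S → ℝ} (hP : ∀ h s a, P h s a ∈ stdSimplex ℝ S)
    (π : Policy S A H) (k : Fin (H + 1)) (s : S) :
    ∑ x ∈ trajectories k s, pathProb P π k x = 1 := by
  induction k using Fin.reverseInduction generalizing s with
  | last => rw [trajectories_last, Finset.sum_singleton, pathProb_last]
  | cast h ih =>
    rw [sum_trajectories_castSucc, ← (hP h s (π h s)).2]
    refine Finset.sum_congr rfl fun s' _ => ?_
    rw [← mul_one (P h s (π h s) s'), ← ih s', Finset.mul_sum]
    refine Finset.sum_congr rfl fun y hy => ?_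
    rw [pathProb_castSucc_freezeUpTo, mem_trajectories.1 hy _ le_rfl]

theorem policyValue_eq_sum (r : Fin H → S → A → ℝ) (P : Fin H → S → A → S → ℝ) (π : Policy S A H)
    (k : Fin (H + 1)) (s : S) :
    policyValue r P π k s = ∑ x ∈ trajectories k s, pathProb P π k x * pathReward r π k x := rfl

theorem policyValue_last (r : Fin H → S → A → ℝ) (P : Fin H → S → A → S → ℝ) (π : Policy S A H)
    (s : S) : policyValue r P π (Fin.last H) s = 0 := by
  simp only [policyValue_eq_sum, pathReward_last, mul_zero, Finset.sum_const_zero]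

theorem policyValue_castSucc (r : Fin H → S → A → ℝ) {P : Fin H → S → A → S → ℝ}
    (hP : ∀ h s a, P h s a ∈ stdSimplex ℝ S) (π : Policy S A H) (h : Fin H) (s : S) :
    policyValue r P π h.castSucc s =
      r h s (π h s) + ∑ s', P h s (π h s) s' * policyValue r P π h.succ s' := by
  have hstep : ∀ s', ∑ y ∈ trajectories h.succ s',
      pathProb P π h.castSucc (freezeUpTo h.castSucc s y) *
        pathReward r π h.castSucc (freezeUpTo h.castSucc s y) =
      P h s (π h s) s' * r h s (π h s) + P h s (π h s) s' * policyValue r P π h.succ s' := by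
    intro s'
    rw [← mul_add, ← one_mul (r h s (π h s)), ← sum_pathProb hP π h.succ s', policyValue_eq_sum,
      Finset.sum_mul, ← Finset.sum_add_distrib, Finset.mul_sum]
    refine Finset.sum_congr rfl fun y hy => ?_
    rw [pathProb_castSucc_freezeUpTo, pathReward_castSucc_freezeUpTo,
      mem_trajectories.1 hy _ le_rfl]
    ring
  rw [policyValue_eq_sum, sum_trajectories_castSucc, Finset.sum_congr rfl fun s' _ => hstep s',
    Finset.sum_add_distrib, ← Finset.sum_mul, (hP h s (π h s)).2, one_mul]

end Trajectories

section BackwardIterate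

variable {E : Type*} {H : ℕ}

/-- Backward recursion from the terminal value `v` with the time-dependent operators `T h`, which
take a value at time `h + 1` to a value at time `h`. -/
def backwardIterate (T : Fin H → E → E) (v : E) : Fin (H + 1) → E :=
  Fin.reverseInduction (motive := fun _ => E) v T

theorem backwardIterate_last (T : Fin H → E → E) (v : E) :
    backwardIterate T v (Fin.last H) = v :=
  Fin.reverseInduction_last ..

theorem backwardIterate_castSucc (T : Fin H → E → E) (v : E) (h : Fin H) :
    backwardIterate T v h.castSucc = T h (backwardIterate T v h.succ) :=
  Fin.reverseInduction_castSucc ..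

theorem eq_backwardIterate {T : Fin H → E → E} {v : E} {u : Fin (H + 1) → E}
    (hlast : u (Fin.last H) = v)
    (hstep : ∀ h, u h.succ = backwardIterate T v h.succ →
      u h.castSucc = T h (backwardIterate T v h.succ)) : u = backwardIterate T v := by
  funext k
  induction k using Fin.reverseInduction with
  | last => rw [hlast, backwardIterate_last]
  | cast h ih => rw [hstep h ih, backwardIterate_castSucc]

theorem backwardIterate_le [Preorder E] {T : Fin H → E → E} (hT : ∀ h, Monotone (T h)) {v : E}
    {u : Fin (H + 1) → E} (hlast : v ≤ u (Fin.last H))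
    (hstep : ∀ h, T h (u h.succ) ≤ u h.castSucc) (k : Fin (H + 1)) :
    backwardIterate T v k ≤ u k := by
  induction k using Fin.reverseInduction with
  | last => rwa [backwardIterate_last]
  | cast h ih => exact (backwardIterate_castSucc T v h).trans_le ((hT h ih).trans (hstep h))

theorem dist_backwardIterate_le [PseudoMetricSpace E] {T T' : Fin H → E → E}
    (hT' : ∀ h, LipschitzWith 1 (T' h)) {v : E} {e : ℝ}
    (he : ∀ h, dist (T h (backwardIterate T v h.succ)) (T' h (backwardIterate T v h.succ)) ≤ e)
    (k : Fin (H + 1)) :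
    dist (backwardIterate T v k) (backwardIterate T' v k) ≤ (H - k) * e := by
  induction k using Fin.reverseInduction with
  | last => simp [backwardIterate_last]
  | cast h ih =>
    rw [backwardIterate_castSucc, backwardIterate_castSucc]
    calc _ ≤ e + dist (backwardIterate T v h.succ) (backwardIterate T' v h.succ) :=
          (dist_triangle _ _ _).trans (add_le_add (he h) ((hT' h).dist_le_mul_of_le le_rfl |>.trans
            (by rw [NNReal.coe_one, one_mul])))
      _ ≤ e + (H - h.succ) * e := by gcongr
      _ = (H - h.castSucc) * e := by push_cast [Fin.val_succ, Fin.val_castSucc]; ring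

theorem backwardIterate_zero_mem_Icc {S : Type*} {T : Fin H → (S → ℝ) → S → ℝ}
    (hT : ∀ h V c, (∀ s, V s ∈ Set.Icc 0 c) → ∀ s, T h V s ∈ Set.Icc 0 (c + 1)) (k : Fin (H + 1))
    (s : S) : backwardIterate T 0 k s ∈ Set.Icc (0 : ℝ) H := by
  suffices h : ∀ s, backwardIterate T 0 k s ∈ Set.Icc (0 : ℝ) (H - k) from
    ⟨(h s).1, (h s).2.trans (sub_le_self _ (Nat.cast_nonneg _))⟩
  induction k using Fin.reverseInduction with
  | last => simp [backwardIterate_last]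
  | cast h ih =>
    intro s
    rw [backwardIterate_castSucc]
    convert hT h _ _ ih s using 2
    push_cast [Fin.val_succ, Fin.val_castSucc]
    ring

end BackwardIterate

section RobustBellman

variable {S A : Type*} [Fintype S] {H N : ℕ} {ρ e : ℝ} {r : Fin H → S → A → ℝ}
  {P Q : Fin H → S → A → S → ℝ} {π : Policy S A H}

/-- The robust state-action value at time `h`, for KL balls around `P`, when `V` is the value
function at time `h + 1`. -/
def robustActionValue (r : Fin H → S → A → ℝ) (P : Fin H → S → A → S → ℝ) (ρ : ℝ) (h : Fin H)
    (V : S → ℝ) (s : S) (a : A) : ℝ :=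
  r h s a + worstCase (P h s a) ρ V

/-- The robust Bellman operator of the policy `π` at time `h`. -/
def policyOperator (r : Fin H → S → A → ℝ) (P : Fin H → S → A → S → ℝ) (ρ : ℝ) (π : Policy S A H)
    (h : Fin H) (V : S → ℝ) (s : S) : ℝ :=
  robustActionValue r P ρ h V s (π h s)

/-- The robust Bellman optimality operator at time `h`. -/
def optimalityOperator (r : Fin H → S → A → ℝ) (P : Fin H → S → A → S → ℝ) (ρ : ℝ) (h : Fin H)
    (V : S → ℝ) (s : S) : ℝ :=
  ⨆ a, robustActionValue r P ρ h V s a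

theorem rpvlValue_eq_backwardIterate [DecidableEq S] (r : Fin H → S → A → ℝ) (ρ : ℝ)
    (D : Dataset S A H N) :
    rpvlValue r ρ D = backwardIterate (optimalityOperator r (empirical D) ρ) 0 := rfl

theorem dist_ciSup_le {ι : Type*} [Finite ι] [Nonempty ι] {f g : ι → ℝ}
    (h : ∀ i, dist (f i) (g i) ≤ e) : dist (⨆ i, f i) (⨆ i, g i) ≤ e := by
  have hle : ∀ {f g : ι → ℝ}, (∀ i, dist (f i) (g i) ≤ e) → (⨆ i, f i) - ⨆ i, g i ≤ e :=
    fun {f g} h => sub_le_iff_le_add.2 <| ciSup_le fun i => sub_le_iff_le_add.1 <|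
      (sub_le_sub_left (le_ciSup (Set.finite_range g).bddAbove i) _).trans
        ((le_abs_self _).trans (h i))
  rw [Real.dist_eq, abs_sub_le_iff]
  exact ⟨hle h, hle fun i => dist_comm (f i) (g i) ▸ h i⟩

theorem dist_policyOperator_le {h : Fin H} {V W : S → ℝ} (he : 0 ≤ e)
    (hVW : ∀ s a, dist (worstCase (P h s a) ρ V) (worstCase (Q h s a) ρ W) ≤ e) :
    dist (policyOperator r P ρ π h V) (policyOperator r Q ρ π h W) ≤ e :=
  (dist_pi_le_iff he).2 fun s => (dist_add_left _ _ _).trans_le (hVW s (π h s))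

theorem policyOperator_mono (hP : ∀ h s a, P h s a ∈ stdSimplex ℝ S) (hρ : 0 ≤ ρ) (h : Fin H) :
    Monotone (policyOperator r P ρ π h) := fun _ _ hVW s =>
  add_le_add_right (worstCase_mono (hP h s (π h s)) hρ hVW) _

theorem lipschitzWith_policyOperator (hP : ∀ h s a, P h s a ∈ stdSimplex ℝ S) (hρ : 0 ≤ ρ)
    (h : Fin H) : LipschitzWith 1 (policyOperator r P ρ π h) :=
  LipschitzWith.of_dist_le_mul fun V W => dist_policyOperator_le (by positivity) fun s a =>
    (lipschitzWith_worstCase (hP h s a) hρ).dist_le_mul V W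

theorem robustActionValue_mem_Icc (hr : ∀ h s a, r h s a ∈ Set.Icc (0 : ℝ) 1)
    (hP : ∀ h s a, P h s a ∈ stdSimplex ℝ S) (hρ : 0 ≤ ρ) (h : Fin H) {V : S → ℝ} {c : ℝ}
    (hV : ∀ s, V s ∈ Set.Icc 0 c) (s : S) (a : A) :
    robustActionValue r P ρ h V s a ∈ Set.Icc 0 (c + 1) := by
  have hw := worstCase_mem_Icc (hP h s a) hρ hV
  exact ⟨add_nonneg (hr h s a).1 hw.1, by
    rw [add_comm c]; exact add_le_add (hr h s a).2 hw.2⟩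

theorem backwardIterate_policyOperator_mem_Icc (hr : ∀ h s a, r h s a ∈ Set.Icc (0 : ℝ) 1)
    (hP : ∀ h s a, P h s a ∈ stdSimplex ℝ S) (hρ : 0 ≤ ρ) (k : Fin (H + 1)) (s : S) :
    backwardIterate (policyOperator r P ρ π) 0 k s ∈ Set.Icc (0 : ℝ) H :=
  backwardIterate_zero_mem_Icc
    (fun h _ _ hV s => robustActionValue_mem_Icc hr hP hρ h hV s (π h s)) k s

theorem robustValue_eq_backwardIterate [DecidableEq S] (M : MDP S A H) (hρ : 0 < ρ)
    (π : Policy S A H) :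
    M.robustValue ρ π = backwardIterate (policyOperator M.reward M.trans ρ π) 0 := by
  choose Q hQ hQmin using fun h s a => exists_mem_klBall_sum_eq_worstCase (M.trans_mem h s a) hρ
    (backwardIterate_policyOperator_mem_Icc (π := π) M.reward_mem M.trans_mem hρ.le h.succ)
  have hattained :
      policyValue M.reward Q π = backwardIterate (policyOperator M.reward M.trans ρ π) 0 := by
    refine eq_backwardIterate (funext fun s => policyValue_last _ _ _ s)
      fun h ih => funext fun s => ?_
    rw [policyValue_castSucc _ fun h s a => (mem_klBall_iff.1 (hQ h s a)).1, ih, hQmin]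
    rfl
  have hle : ∀ Q' ∈ M.uncertaintySet ρ, ∀ k,
      backwardIterate (policyOperator M.reward M.trans ρ π) 0 k ≤ policyValue M.reward Q' π k := by
    intro Q' hQ'
    refine backwardIterate_le (policyOperator_mono M.trans_mem hρ.le)
      (fun s => (policyValue_last _ _ _ s).ge) fun h s => ?_
    rw [policyValue_castSucc _ fun h s a => (mem_klBall_iff.1 (hQ' h s a)).1]
    exact add_le_add_right (worstCase_le_sum (M.trans_mem h s (π h s)) (hQ' h s (π h s)) _) _
  funext k s
  refine IsLeast.csInf_eq ⟨⟨⟨Q, hQ⟩, congrFun₂ hattained k s⟩, ?_⟩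
  rintro _ ⟨Q', rfl⟩
  exact hle Q'.1 Q'.2 k s

theorem backwardIterate_policyOperator_of_isRPVLOutput [DecidableEq S] [Finite A] [Nonempty A]
    {D : Dataset S A H N} (hπ : IsRPVLOutput r ρ D π) :
    backwardIterate (policyOperator r (empirical D) ρ π) 0 = rpvlValue r ρ D := by
  refine eq_backwardIterate (backwardIterate_last _ _) fun h ih => ?_
  rw [backwardIterate_castSucc, ih]
  funext s
  exact (le_ciSup (Set.finite_range _).bddAbove (π h s)).antisymm (ciSup_le (hπ h s))

variable [Finite A] [Nonempty A]

theorem dist_optimalityOperator_le {h : Fin H} {V W : S → ℝ} (he : 0 ≤ e)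
    (hVW : ∀ s a, dist (worstCase (P h s a) ρ V) (worstCase (Q h s a) ρ W) ≤ e) :
    dist (optimalityOperator r P ρ h V) (optimalityOperator r Q ρ h W) ≤ e :=
  (dist_pi_le_iff he).2 fun s => dist_ciSup_le fun a =>
    (dist_add_left _ _ _).trans_le (hVW s a)

theorem lipschitzWith_optimalityOperator (hP : ∀ h s a, P h s a ∈ stdSimplex ℝ S) (hρ : 0 ≤ ρ)
    (h : Fin H) : LipschitzWith 1 (optimalityOperator r P ρ h) :=
  LipschitzWith.of_dist_le_mul fun V W => dist_optimalityOperator_le (by positivity) fun s a =>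
    (lipschitzWith_worstCase (hP h s a) hρ).dist_le_mul V W

theorem exists_backwardIterate_policyOperator_eq (r : Fin H → S → A → ℝ)
    (P : Fin H → S → A → S → ℝ) (ρ : ℝ) :
    ∃ π : Policy S A H, backwardIterate (policyOperator r P ρ π) 0 =
      backwardIterate (optimalityOperator r P ρ) 0 := by
  choose π hπ using fun (h : Fin H) (s : S) => exists_eq_ciSup_of_finite
    (f := robustActionValue r P ρ h (backwardIterate (optimalityOperator r P ρ) 0 h.succ) s)
  refine ⟨π, eq_backwardIterate (backwardIterate_last _ _) fun h ih => ?_⟩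
  rw [backwardIterate_castSucc, ih]
  exact funext (hπ h)

theorem backwardIterate_optimalityOperator_mem_Icc (hr : ∀ h s a, r h s a ∈ Set.Icc (0 : ℝ) 1)
    (hP : ∀ h s a, P h s a ∈ stdSimplex ℝ S) (hρ : 0 ≤ ρ) (k : Fin (H + 1)) (s : S) :
    backwardIterate (optimalityOperator r P ρ) 0 k s ∈ Set.Icc (0 : ℝ) H := by
  obtain ⟨π, hπ⟩ := exists_backwardIterate_policyOperator_eq r P ρ
  rw [← hπ]
  exact backwardIterate_policyOperator_mem_Icc hr hP hρ k s

variable [DecidableEq S] (M : MDP S A H)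

theorem optRobustValue_eq_backwardIterate (hρ : 0 < ρ) :
    M.optRobustValue ρ = backwardIterate (optimalityOperator M.reward M.trans ρ) 0 := by
  obtain ⟨π, hπ⟩ := exists_backwardIterate_policyOperator_eq M.reward M.trans ρ
  funext k s
  refine IsGreatest.csSup_eq ⟨⟨π, ?_⟩, ?_⟩
  · dsimp only
    rw [robustValue_eq_backwardIterate M hρ, hπ]
  · rintro _ ⟨π', rfl⟩
    dsimp only
    rw [robustValue_eq_backwardIterate M hρ]
    refine backwardIterate_le (policyOperator_mono M.trans_mem hρ.le)
      (backwardIterate_last _ _).ge (fun h s => ?_) k s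
    rw [backwardIterate_castSucc]
    exact le_ciSup (f := robustActionValue M.reward M.trans ρ h _ s)
      (Set.finite_range _).bddAbove (π' h s)

theorem optRobustValue_mem_Icc (hρ : 0 < ρ) (k : Fin (H + 1)) (s : S) :
    M.optRobustValue ρ k s ∈ Set.Icc (0 : ℝ) H := by
  rw [optRobustValue_eq_backwardIterate M hρ]
  exact backwardIterate_optimalityOperator_mem_Icc M.reward_mem M.trans_mem hρ.le k s

variable {D : Dataset S A H N}

theorem rpvlValue_mem_Icc (hρ : 0 ≤ ρ) (hD : ∀ h s a, empirical D h s a ∈ stdSimplex ℝ S)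
    (k : Fin (H + 1)) (s : S) : rpvlValue M.reward ρ D k s ∈ Set.Icc (0 : ℝ) H :=
  backwardIterate_optimalityOperator_mem_Icc M.reward_mem hD hρ k s

theorem dist_rpvlValue_robustValue_le (hρ : 0 < ρ) (hπ : IsRPVLOutput M.reward ρ D π) (he : 0 ≤ e)
    (herr : ∀ (h : Fin H) s a,
      dist (worstCase (empirical D h s a) ρ (rpvlValue M.reward ρ D h.succ))
        (worstCase (M.trans h s a) ρ (rpvlValue M.reward ρ D h.succ)) ≤ e) (k : Fin (H + 1)) :
    dist (rpvlValue M.reward ρ D k) (M.robustValue ρ π k) ≤ (H - k) * e := by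
  rw [robustValue_eq_backwardIterate M hρ]
  rw [← backwardIterate_policyOperator_of_isRPVLOutput hπ] at herr ⊢
  exact dist_backwardIterate_le (lipschitzWith_policyOperator M.trans_mem hρ.le)
    (fun h => dist_policyOperator_le he (herr h)) k

theorem dist_optRobustValue_robustValue_le (hρ : 0 < ρ) (hπ : IsRPVLOutput M.reward ρ D π)
    (he : 0 ≤ e) (herr : ∀ (h : Fin H) s a,
      dist (worstCase (empirical D h s a) ρ (rpvlValue M.reward ρ D h.succ))
        (worstCase (M.trans h s a) ρ (rpvlValue M.reward ρ D h.succ)) ≤ e) (k : Fin (H + 1)) :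
    dist (M.optRobustValue ρ k) (M.robustValue ρ π k) ≤ 2 * (H - k) * e := by
  have hopt : dist (rpvlValue M.reward ρ D k) (M.optRobustValue ρ k) ≤ (H - k) * e := by
    rw [optRobustValue_eq_backwardIterate M hρ]
    exact dist_backwardIterate_le (lipschitzWith_optimalityOperator M.trans_mem hρ.le)
      (fun h => dist_optimalityOperator_le he (herr h)) k
  linarith [dist_triangle_left (M.optRobustValue ρ k) (M.robustValue ρ π k)
    (rpvlValue M.reward ρ D k), dist_rpvlValue_robustValue_le M hρ hπ he herr k]

/- The estimation errors at the optimal value functions control those at the algorithm's value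
functions, because the worst-case expectations are nonexpansive. -/
theorem dist_optRobustValue_robustValue_le_of_optimal (hρ : 0 < ρ)
    (hD : ∀ h s a, empirical D h s a ∈ stdSimplex ℝ S) (hπ : IsRPVLOutput M.reward ρ D π)
    (he : 0 ≤ e) (herr : ∀ (h : Fin H) s a,
      dist (worstCase (M.trans h s a) ρ (M.optRobustValue ρ h.succ))
        (worstCase (empirical D h s a) ρ (M.optRobustValue ρ h.succ)) ≤ e) :
    dist (M.optRobustValue ρ 0) (M.robustValue ρ π 0) ≤ 2 * H ^ 2 * e := by
  have hopt : ∀ k, dist (M.optRobustValue ρ k) (rpvlValue M.reward ρ D k) ≤ (H - k) * e := by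
    rw [optRobustValue_eq_backwardIterate M hρ] at herr ⊢
    exact dist_backwardIterate_le (lipschitzWith_optimalityOperator hD hρ.le)
      (fun h => dist_optimalityOperator_le he (herr h))
  have herr' : ∀ (h : Fin H) s a,
      dist (worstCase (empirical D h s a) ρ (rpvlValue M.reward ρ D h.succ))
        (worstCase (M.trans h s a) ρ (rpvlValue M.reward ρ D h.succ)) ≤ (2 * H - 1) * e := by
    intro h s a
    have hcast : (h : ℝ) + 1 ≤ H := by exact_mod_cast h.2
    have hV : dist (rpvlValue M.reward ρ D h.succ) (M.optRobustValue ρ h.succ) ≤ (H - 1) * e := by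
      rw [dist_comm]
      refine (hopt h.succ).trans (mul_le_mul_of_nonneg_right ?_ he)
      push_cast [Fin.val_succ]
      linarith [hcast, Nat.cast_nonneg (α := ℝ) (h : ℕ)]
    have hlip : ∀ {p : S → ℝ}, p ∈ stdSimplex ℝ S →
        dist (worstCase p ρ (rpvlValue M.reward ρ D h.succ))
          (worstCase p ρ (M.optRobustValue ρ h.succ)) ≤ (H - 1) * e := fun hp =>
      ((lipschitzWith_worstCase hp hρ.le).dist_le_mul _ _).trans
        (by rwa [NNReal.coe_one, one_mul])
    have hp := hlip (M.trans_mem h s a)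
    have hq := hlip (hD h s a)
    have hpq := herr h s a
    rw [dist_comm] at hp hpq
    linarith [dist_triangle4 (worstCase (empirical D h s a) ρ (rpvlValue M.reward ρ D h.succ))
      (worstCase (empirical D h s a) ρ (M.optRobustValue ρ h.succ))
      (worstCase (M.trans h s a) ρ (M.optRobustValue ρ h.succ))
      (worstCase (M.trans h s a) ρ (rpvlValue M.reward ρ D h.succ))]
  rcases Nat.eq_zero_or_pos H with rfl | hH
  · simpa using dist_optRobustValue_robustValue_le M hρ hπ he (fun h => h.elim0) 0
  have hH1 : (1 : ℝ) ≤ H := by exact_mod_cast hH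
  have hrobust := dist_rpvlValue_robustValue_le M hρ hπ (mul_nonneg (by linarith) he) herr' 0
  have hopt0 := hopt 0
  rw [Fin.val_zero, Nat.cast_zero, sub_zero] at hrobust hopt0
  linarith [dist_triangle (M.optRobustValue ρ 0) (rpvlValue M.reward ρ D 0) (M.robustValue ρ π 0)]

end RobustBellman

section Perturbation

open Set

theorem integral_ite_le_one {c : ℝ} (hc : c ∈ Icc (0 : ℝ) 1) (w : ℝ) :
    ∫ t in (0 : ℝ)..1, (if t ≤ c then w else 0) = w * c := by
  have hind : (fun t => if t ≤ c then w else 0) = indicator {t | t ≤ c} fun _ => w := rfl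
  rw [hind, intervalIntegral.integral_indicator hc, intervalIntegral.integral_const, sub_zero,
    smul_eq_mul, mul_comm]

theorem intervalIntegrable_ite_le (c w a b : ℝ) :
    IntervalIntegrable (fun t => if t ≤ c then w else 0) volume a b := by
  have h : AntitoneOn (fun t : ℝ => if t ≤ c then (1 : ℝ) else 0) (uIcc a b) :=
    fun x _ y _ hxy => by
      dsimp only
      split_ifs with hy hx
      exacts [le_rfl, (hx (hxy.trans hy)).elim, zero_le_one, le_rfl]
  simpa only [mul_ite, mul_one, mul_zero] using h.intervalIntegrable.const_mul w

/- Layer cake: `∑ w f` is the integral over `t` of the weights of the superlevel sets. -/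
theorem abs_sum_mul_le_of_abs_sum_filter_le {ι : Type*} [Fintype ι] {w f : ι → ℝ} {η : ℝ}
    (hf : ∀ i, f i ∈ Icc (0 : ℝ) 1) (h : ∀ t, |∑ i with t ≤ f i, w i| ≤ η) :
    |∑ i, w i * f i| ≤ η := by
  have hlayer : ∑ i, w i * f i = ∫ t in (0 : ℝ)..1, ∑ i with t ≤ f i, w i := by
    simp only [Finset.sum_filter]
    rw [intervalIntegral.integral_finsetSum fun i _ => intervalIntegrable_ite_le _ _ _ _]
    exact Finset.sum_congr rfl fun i _ => (integral_ite_le_one (hf i) (w i)).symm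
  rw [hlayer]
  simpa using intervalIntegral.norm_integral_le_of_norm_le_const (a := 0) (b := 1)
    (f := fun t => ∑ i with t ≤ f i, w i) fun t _ => h t

variable {S : Type*} [Fintype S] {p q V : S → ℝ} {ρ B C c lam lam₀ η η₀ : ℝ}

/-- The distribution functions of `V` under `p` and `q` differ by at most `η`. -/
def SublevelClose (p q V : S → ℝ) (η : ℝ) : Prop :=
  ∀ s, |sublevelProb q V (V s) - sublevelProb p V (V s)| ≤ η

theorem SublevelClose.abs_sum_filter_le (h : SublevelClose p q V η) (hη : 0 ≤ η) {φ : ℝ → ℝ}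
    (hφ : Antitone φ) (t : ℝ) : |∑ s with t ≤ φ (V s), (q s - p s)| ≤ η := by
  rcases Finset.eq_empty_or_nonempty ({s | t ≤ φ (V s)} : Finset S) with h0 | h0
  · rwa [h0, Finset.sum_empty, abs_zero]
  · obtain ⟨m, hm, hmax⟩ := Finset.exists_max_image _ V h0
    have hfilter : ({s | t ≤ φ (V s)} : Finset S) = ({s | V s ≤ V m} : Finset S) := by
      ext s
      simp only [Finset.mem_filter, Finset.mem_univ, true_and] at hm hmax ⊢
      exact ⟨hmax s, fun hs => hm.trans (hφ hs)⟩
    rw [hfilter, Finset.sum_sub_distrib]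
    exact h m

theorem SublevelClose.abs_expMoment_sub_le (h : SublevelClose p q V η) (hη : 0 ≤ η)
    (hp : ∀ s, V s < c → p s = 0) (hq : ∀ s, V s < c → q s = 0) (hlam : 0 < lam) :
    |expMoment q V c lam - expMoment p V c lam| ≤ η := by
  have hφ : Antitone fun v : ℝ => Real.exp (-(max v c - c) / lam) := fun x y hxy => by
    dsimp only; gcongr
  have hφ01 : ∀ v : ℝ, Real.exp (-(max v c - c) / lam) ∈ Icc (0 : ℝ) 1 := fun v =>
    ⟨(Real.exp_pos _).le, Real.exp_le_one_iff.2
      (div_nonpos_of_nonpos_of_nonneg (by linarith [le_max_right v c]) hlam.le)⟩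
  have hdiff : expMoment q V c lam - expMoment p V c lam =
      ∑ s, (q s - p s) * Real.exp (-(max (V s) c - c) / lam) := by
    rw [expMoment, expMoment, ← Finset.sum_sub_distrib]
    refine Finset.sum_congr rfl fun s _ => ?_
    rcases lt_or_ge (V s) c with hs | hs
    · simp [hp s hs, hq s hs]
    · rw [max_eq_left hs, sub_mul]
  rw [hdiff]
  exact abs_sum_mul_le_of_abs_sum_filter_le (fun s => hφ01 (V s)) (h.abs_sum_filter_le hη hφ)

theorem abs_log_sub_log_le {x y b : ℝ} (hb : 0 < b) (hx : b ≤ x) (hy : b ≤ y) :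
    |Real.log x - Real.log y| ≤ |x - y| / b := by
  have hle : ∀ {x y : ℝ}, b ≤ x → b ≤ y → Real.log x - Real.log y ≤ |x - y| / b := by
    intro x y hx hy
    have hx0 := hb.trans_le hx
    have hy0 := hb.trans_le hy
    calc Real.log x - Real.log y = Real.log (x / y) := (Real.log_div hx0.ne' hy0.ne').symm
      _ ≤ x / y - 1 := Real.log_le_sub_one_of_pos (div_pos hx0 hy0)
      _ = (x - y) / y := by rw [sub_div, div_self hy0.ne']
      _ ≤ |x - y| / b := div_le_div₀ (abs_nonneg _) (le_abs_self _) hb hy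
  exact abs_sub_le_iff.2 ⟨hle hx hy, abs_sub_comm x y ▸ hle hy hx⟩

theorem abs_dualObjective_sub_le (hp : p ∈ stdSimplex ℝ S) (hq : q ∈ stdSimplex ℝ S)
    (ρ : ℝ) (hlam : 0 < lam) {b : ℝ} (hb : 0 < b) (hbp : b ≤ expMoment p V c lam)
    (hbq : b ≤ expMoment q V c lam) (h : |expMoment q V c lam - expMoment p V c lam| ≤ η) :
    |dualObjective q ρ V lam - dualObjective p ρ V lam| ≤ lam * (η / b) := by
  rw [dualObjective_eq hp ρ V c hlam, dualObjective_eq hq ρ V c hlam, add_sub_add_left_eq_sub,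
    ← mul_sub, abs_mul, abs_of_pos hlam]
  gcongr
  exact (abs_log_sub_log_le hb hbq hbp).trans (by gcongr)

theorem exp_neg_div_le_expMoment (hp : p ∈ stdSimplex ℝ S) (hV : ∀ s, V s ∈ Icc 0 B)
    (hlam₀ : 0 < lam₀) (hlam : lam₀ ≤ lam) : Real.exp (-(B / lam₀)) ≤ expMoment p V 0 lam := by
  refine le_sum_mul hp fun s _ => Real.exp_le_exp.2 ?_
  rw [neg_div, sub_zero, neg_le_neg_iff]
  exact div_le_div₀ ((hV s).1.trans (hV s).2) (hV s).2 hlam₀ hlam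

theorem SublevelClose.abs_dualObjective_sub_le (h : SublevelClose p q V η)
    (hp : p ∈ stdSimplex ℝ S) (hq : q ∈ stdSimplex ℝ S) (hV : ∀ s, V s ∈ Icc 0 B) (hη : 0 ≤ η)
    (hlam₀ : 0 < lam₀) (hlam : lam ∈ Icc lam₀ (B / ρ)) :
    |dualObjective q ρ V lam - dualObjective p ρ V lam| ≤ B / ρ * Real.exp (B / lam₀) * η := by
  have hlam0 := hlam₀.trans_le hlam.1
  have hmoment := h.abs_expMoment_sub_le (c := 0) hη (fun s hs => absurd (hV s).1 hs.not_ge)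
    (fun s hs => absurd (hV s).1 hs.not_ge) hlam0
  calc |dualObjective q ρ V lam - dualObjective p ρ V lam|
      ≤ lam * (η / Real.exp (-(B / lam₀))) :=
        RobustRL.abs_dualObjective_sub_le hp hq ρ hlam0 (Real.exp_pos _)
          (exp_neg_div_le_expMoment hp hV hlam₀ hlam.1)
          (exp_neg_div_le_expMoment hq hV hlam₀ hlam.1) hmoment
    _ ≤ B / ρ * (η / Real.exp (-(B / lam₀))) := by gcongr; exact hlam.2
    _ = B / ρ * Real.exp (B / lam₀) * η := by
      rw [Real.exp_neg, div_inv_eq_mul, mul_comm η, mul_assoc]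

theorem SublevelClose.dist_worstCase_le (h : SublevelClose p q V η) (hp : p ∈ stdSimplex ℝ S)
    (hq : q ∈ stdSimplex ℝ S) (hρ : 0 < ρ) (hV : ∀ s, V s ∈ Icc 0 B) (hη : 0 ≤ η)
    (hlam₀ : 0 < lam₀) (hlamp : lam₀ ≤ dualOptimizer p ρ B V)
    (hlamq : lam₀ ≤ dualOptimizer q ρ B V) :
    dist (worstCase p ρ V) (worstCase q ρ V) ≤ B / ρ * Real.exp (B / lam₀) * η := by
  have hx := dualOptimizer_mem_Icc hp hρ hV
  have hy := dualOptimizer_mem_Icc hq hρ hV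
  rw [worstCase_eq_neg_dualObjective_dualOptimizer hp hρ hV,
    worstCase_eq_neg_dualObjective_dualOptimizer hq hρ hV, dist_neg_neg, Real.dist_eq,
    abs_sub_le_iff]
  have hpq := abs_sub_le_iff.1 (h.abs_dualObjective_sub_le hp hq hV hη hlam₀ ⟨hlamp, hx.2⟩)
  have hqp := abs_sub_le_iff.1 (h.abs_dualObjective_sub_le hp hq hV hη hlam₀ ⟨hlamq, hy.2⟩)
  have hminp := isMinOn_iff.1 (isMinOn_dualOptimizer hp hρ hV) _ hy.1
  have hminq := isMinOn_iff.1 (isMinOn_dualOptimizer hq hρ hV) _ hx.1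
  exact ⟨by linarith, by linarith⟩

theorem dualObjective_dualOptimizer_lt (hp : p ∈ stdSimplex ℝ S) (hρ : 0 < ρ)
    (hV : ∀ s, V s ∈ Icc 0 B) (hlam : lam ∈ Ico 0 (dualOptimizer p ρ B V)) :
    dualObjective p ρ V (dualOptimizer p ρ B V) < dualObjective p ρ V lam := by
  by_contra! hle
  have hmin := isMinOn_dualOptimizer hp hρ hV
  refine hlam.2.not_ge (csInf_le ⟨0, fun y hy => hy.1.1⟩
    ⟨⟨hlam.1, hlam.2.le.trans (dualOptimizer_mem_Icc hp hρ hV).2⟩, fun z hz => ?_⟩)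
  exact hle.trans (hmin hz.1)

theorem le_dualOptimizer_of_dualObjective_lt (hp : p ∈ stdSimplex ℝ S) (hρ : 0 < ρ)
    (hV : ∀ s, V s ∈ Icc 0 B) {x : ℝ} (hx : lam ≤ x)
    (h : dualObjective p ρ V x < dualObjective p ρ V lam) : lam ≤ dualOptimizer p ρ B V := by
  by_contra! hlt
  have hy := (dualOptimizer_mem_Icc hp hρ hV).1
  have hx0 : 0 ≤ x := hy.trans (hlt.le.trans hx)
  refine h.not_ge (((convexOn_dualObjective hp ρ V).le_max_of_mem_Icc hy hx0
    ⟨hlt.le, hx⟩).trans (max_le ?_ le_rfl))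
  exact isMinOn_dualOptimizer hp hρ hV hx0

/-- Perturbing `p` by at most `η ≤ η₀`, in the sense of the distribution function of `V` and
without enlarging the support, changes the worst-case expectation of `V` by at most `C * η`. -/
def IsStabilityRadius (p : S → ℝ) (ρ : ℝ) (V : S → ℝ) (C η₀ : ℝ) : Prop :=
  ∀ q ∈ stdSimplex ℝ S, (∀ s, p s = 0 → q s = 0) → ∀ η ∈ Icc 0 η₀, SublevelClose p q V η →
    dist (worstCase p ρ V) (worstCase q ρ V) ≤ C * η

theorem IsStabilityRadius.anti {η₁ : ℝ} (h : IsStabilityRadius p ρ V C η₀) (hη : η₁ ≤ η₀) :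
    IsStabilityRadius p ρ V C η₁ :=
  fun q hq hqp η hη₁ => h q hq hqp η ⟨hη₁.1, hη₁.2.trans hη⟩

theorem exists_isStabilityRadius_of_lt_dualOptimizer (hp : p ∈ stdSimplex ℝ S) (hρ : 0 < ρ)
    (hV : ∀ s, V s ∈ Icc 0 B) (hlam₀ : 0 < lam₀) (hlt : lam₀ < dualOptimizer p ρ B V) :
    ∃ η₀ > 0, IsStabilityRadius p ρ V (B / ρ * Real.exp (B / lam₀)) η₀ := by
  have hx := dualOptimizer_mem_Icc hp hρ hV
  have hgap := dualObjective_dualOptimizer_lt hp hρ hV ⟨hlam₀.le, hlt⟩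
  have hC : 0 < B / ρ * Real.exp (B / lam₀) :=
    mul_pos (hlam₀.trans (hlt.trans_le hx.2)) (Real.exp_pos _)
  refine ⟨(dualObjective p ρ V lam₀ - dualObjective p ρ V (dualOptimizer p ρ B V)) /
    (4 * (B / ρ * Real.exp (B / lam₀))), by have := sub_pos.2 hgap; positivity,
    fun q hq _ η hη h => h.dist_worstCase_le hp hq hρ hV hη.1 hlam₀ hlt.le ?_⟩
  refine le_dualOptimizer_of_dualObjective_lt hq hρ hV hlt.le ?_
  have hηle := (le_div_iff₀ (by positivity)).1 hη.2
  have hlow := abs_sub_le_iff.1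
    (h.abs_dualObjective_sub_le hp hq hV hη.1 hlam₀ ⟨le_rfl, hlt.le.trans hx.2⟩)
  have hopt := abs_sub_le_iff.1 (h.abs_dualObjective_sub_le hp hq hV hη.1 hlam₀ ⟨hlt.le, hx.2⟩)
  linarith

theorem eq_zero_of_lt_suppMin (hp : p ∈ stdSimplex ℝ S) (V : S → ℝ) {s : S}
    (hs : V s < suppMin p V) : p s = 0 := by
  by_contra h
  exact hs.not_ge (suppMin_le V ((hp.1 s).lt_of_ne' h))

theorem suppMin_le_of_sublevelProb_pos (hp : p ∈ stdSimplex ℝ S) (h : 0 < sublevelProb p V c) :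
    suppMin p V ≤ c := by
  obtain ⟨s, hs, hps⟩ := Finset.exists_ne_zero_of_sum_ne_zero h.ne'
  exact (suppMin_le V ((hp.1 s).lt_of_ne' hps)).trans (Finset.mem_filter.1 hs).2

theorem ite_le_mul_exp (hp : p ∈ stdSimplex ℝ S) (V : S → ℝ) (c : ℝ) (hlam : 0 < lam) (s : S) :
    (if V s ≤ c then p s else 0) ≤ p s * Real.exp (-(V s - c) / lam) := by
  split_ifs with hs
  · exact le_mul_of_one_le_right (hp.1 s)
      (Real.one_le_exp (div_nonneg (by linarith) hlam.le))
  · exact mul_nonneg (hp.1 s) (Real.exp_pos _).le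

theorem sublevelProb_le_expMoment (hp : p ∈ stdSimplex ℝ S) (V : S → ℝ) (c : ℝ)
    (hlam : 0 < lam) : sublevelProb p V c ≤ expMoment p V c lam := by
  rw [sublevelProb, Finset.sum_filter]
  exact Finset.sum_le_sum fun s _ => ite_le_mul_exp hp V c hlam s

theorem sublevelProb_lt_expMoment (hp : p ∈ stdSimplex ℝ S) (hlam : 0 < lam)
    (h : sublevelProb p V c < 1) : sublevelProb p V c < expMoment p V c lam := by
  rw [← hp.2, sublevelProb, Finset.sum_filter] at h
  obtain ⟨s, hs, hlt⟩ := Finset.exists_lt_of_sum_lt h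
  have hVs : ¬V s ≤ c := fun hVs => hlt.ne (if_pos hVs)
  rw [if_neg hVs] at hlt
  rw [sublevelProb, Finset.sum_filter]
  refine Finset.sum_lt_sum (fun s _ => ite_le_mul_exp hp V c hlam s) ⟨s, hs, ?_⟩
  rw [if_neg hVs]
  exact mul_pos hlt (Real.exp_pos _)

theorem expMoment_suppMin_le (hp : p ∈ stdSimplex ℝ S) (V : S → ℝ) (hlam₀ : 0 < lam₀)
    (hlam : lam₀ ≤ lam) :
    expMoment p V (suppMin p V) lam₀ ≤ expMoment p V (suppMin p V) lam := by
  refine Finset.sum_le_sum fun s _ => ?_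
  rcases (hp.1 s).eq_or_lt with h0 | h0
  · simp [← h0]
  have hs := sub_nonneg.2 (suppMin_le V h0)
  rw [neg_div, neg_div]
  gcongr

theorem exp_neg_lt_expMoment (hp : p ∈ stdSimplex ℝ S) (hρ : 0 < ρ)
    (h : Real.exp (-ρ) ≤ sublevelProb p V (suppMin p V)) (hlam : 0 < lam) :
    Real.exp (-ρ) < expMoment p V (suppMin p V) lam := by
  rcases lt_or_ge (sublevelProb p V (suppMin p V)) 1 with hw | hw
  · exact h.trans_lt (sublevelProb_lt_expMoment hp hlam hw)
  · exact (Real.exp_lt_one_iff.2 (neg_lt_zero.2 hρ)).trans_le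
      (hw.trans (sublevelProb_le_expMoment hp V _ hlam))

theorem SublevelClose.lt_of_expMoment_le (h : SublevelClose p q V η) (hη : 0 ≤ η)
    (hp : p ∈ stdSimplex ℝ S) (hqp : ∀ s, p s = 0 → q s = 0) {c₀ : ℝ} (hc₀ : 0 < c₀)
    (hηlt : η < expMoment p V (suppMin p V) c₀ - Real.exp (-ρ)) (hlam : 0 < lam)
    (hq : expMoment q V (suppMin p V) lam ≤ Real.exp (-ρ)) : lam < c₀ := by
  have hzero := fun s => eq_zero_of_lt_suppMin hp V (s := s)
  by_contra! hle
  linarith [expMoment_suppMin_le hp V hc₀ hle, (abs_sub_le_iff.1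
    (h.abs_expMoment_sub_le hη hzero (fun s hs => hqp s (hzero s hs)) hlam)).2]

/- The optimal dual variable of `q` is either zero or so small that the factor `lam` of the
perturbation bound compensates the mass of the minimizers of `V`. -/
theorem SublevelClose.dist_worstCase_le_of_exp_neg_le (h : SublevelClose p q V η)
    (hp : p ∈ stdSimplex ℝ S) (hq : q ∈ stdSimplex ℝ S) (hqp : ∀ s, p s = 0 → q s = 0)
    (hρ : 0 < ρ) (hV : ∀ s, V s ∈ Icc 0 B) (hC : 0 < C)
    (hw : Real.exp (-ρ) ≤ sublevelProb p V (suppMin p V)) (hη : 0 ≤ η)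
    (hηw : η ≤ sublevelProb p V (suppMin p V) / 2)
    (hηlt : η < expMoment p V (suppMin p V) (C * (sublevelProb p V (suppMin p V) / 2)) -
      Real.exp (-ρ)) : dist (worstCase p ρ V) (worstCase q ρ V) ≤ C * η := by
  have hw0 := sublevelProb_suppMin_pos hp V
  have hwp := worstCase_eq_suppMin hp hρ.le hw
  have hzero := fun s => eq_zero_of_lt_suppMin hp V (s := s)
  have hle : worstCase p ρ V ≤ worstCase q ρ V := by
    obtain ⟨s, hs, hsm⟩ := exists_eq_suppMin hq V
    rw [hwp]
    exact (suppMin_le V ((hp.1 s).lt_of_ne' fun h0 => hs.ne' (hqp s h0))).trans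
      (hsm.le.trans (suppMin_le_worstCase hq hρ.le V))
  have hqw : sublevelProb p V (suppMin p V) / 2 ≤ sublevelProb q V (suppMin p V) := by
    obtain ⟨s, -, hsm⟩ := exists_eq_suppMin hp V
    linarith [(abs_sub_le_iff.1 (hsm ▸ h s)).2]
  rw [dist_comm, Real.dist_eq, abs_of_nonneg (sub_nonneg.2 hle), sub_le_iff_le_add]
  have hwq := worstCase_eq_neg_dualObjective_dualOptimizer hq hρ hV
  rcases (dualOptimizer_mem_Icc hq hρ hV).1.eq_or_lt with hy | hy
  · rw [← hy, dualObjective_zero, neg_neg] at hwq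
    rw [hwq, hwp]
    linarith [suppMin_le_of_sublevelProb_pos hq ((half_pos hw0).trans_le hqw), mul_nonneg hC.le hη]
  · have hqexp : expMoment q V (suppMin p V) (dualOptimizer q ρ B V) ≤ Real.exp (-ρ) := by
      rw [← dualObjective_le_neg_iff hq hy, ← hwp]
      linarith
    have hsmall := h.lt_of_expMoment_le hη hp hqp (mul_pos hC (half_pos hw0)) hηlt hy hqexp
    have hpert := RobustRL.abs_dualObjective_sub_le hp hq ρ hy (half_pos hw0)
      ((half_le_self hw0.le).trans (sublevelProb_le_expMoment hp V _ hy))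
      (hqw.trans (sublevelProb_le_expMoment hq V _ hy))
      (h.abs_expMoment_sub_le hη hzero (fun s hs => hqp s (hzero s hs)) hy)
    have hscale : dualOptimizer q ρ B V * (η / (sublevelProb p V (suppMin p V) / 2)) ≤ C * η := by
      rw [← mul_div_assoc, div_le_iff₀ (half_pos hw0), mul_right_comm]
      gcongr
    linarith [(abs_sub_le_iff.1 hpert).2, neg_dualObjective_le_worstCase hp hρ.le V hy.le]

theorem exists_isStabilityRadius_of_exp_neg_le (hp : p ∈ stdSimplex ℝ S) (hρ : 0 < ρ)
    (hV : ∀ s, V s ∈ Icc 0 B) (hC : 0 < C)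
    (hw : Real.exp (-ρ) ≤ sublevelProb p V (suppMin p V)) :
    ∃ η₀ > 0, IsStabilityRadius p ρ V C η₀ := by
  have hw0 := half_pos (sublevelProb_suppMin_pos hp V)
  have hgap := sub_pos.2 (exp_neg_lt_expMoment hp hρ hw (mul_pos hC hw0))
  exact ⟨_, lt_min hw0 (half_pos hgap), fun q hq hqp η hη h =>
    h.dist_worstCase_le_of_exp_neg_le hp hq hqp hρ hV hC hw hη.1 (hη.2.trans (min_le_left _ _))
      ((hη.2.trans (min_le_right _ _)).trans_lt (half_lt_self hgap))⟩

theorem exists_isStabilityRadius (hp : p ∈ stdSimplex ℝ S) (hρ : 0 < ρ) (hB : 0 < B)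
    (hV : ∀ s, V s ∈ Icc 0 B) (hlam₀ : 0 < lam₀)
    (h : dualOptimizer p ρ B V = 0 ∨ lam₀ < dualOptimizer p ρ B V) :
    ∃ η₀ > 0, IsStabilityRadius p ρ V (B / ρ * Real.exp (B / lam₀)) η₀ := by
  rcases h with h | h
  · refine exists_isStabilityRadius_of_exp_neg_le hp hρ hV (by positivity)
      (exp_neg_le_sublevelProb hp ?_)
    exact h ▸ isMinOn_dualOptimizer hp hρ hV
  · exact exists_isStabilityRadius_of_lt_dualOptimizer hp hρ hV hlam₀ h

end Perturbation

section DualLowerBound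

variable {S A : Type*} [Fintype S] [DecidableEq S] {H : ℕ} (M : MDP S A H) {ρ : ℝ}

theorem optDual_nonneg [Finite A] [Nonempty A] (hρ : 0 < ρ) (h : Fin H) (s : S) (a : A) :
    0 ≤ M.optDual ρ h s a :=
  (dualOptimizer_mem_Icc (M.trans_mem h s a) hρ (optRobustValue_mem_Icc M hρ h.succ)).1

theorem dualLowerBound_le [Finite A] (ρ : ℝ) (h : Fin H) (s : S) (a : A) :
    M.dualLowerBound ρ ≤ if 0 < M.optDual ρ h s a ∧ M.optDual ρ h s a < 1
      then M.optDual ρ h s a / 2 else 1 / 2 :=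
  ciInf_le (Set.finite_range _).bddBelow (h, s, a)

theorem optDual_eq_zero_or_dualLowerBound_lt [Finite A] [Nonempty A] (hρ : 0 < ρ) (h : Fin H)
    (s : S) (a : A) : M.optDual ρ h s a = 0 ∨ M.dualLowerBound ρ < M.optDual ρ h s a := by
  rcases (optDual_nonneg M hρ h s a).eq_or_lt with h0 | h0
  · exact .inl h0.symm
  have hle := dualLowerBound_le M ρ h s a
  split_ifs at hle with h1
  · exact .inr (by linarith)
  · exact .inr (by linarith [not_lt.1 fun h2 => h1 ⟨h0, h2⟩])

theorem dualLowerBound_mem_Ioc [Finite A] [Nonempty S] [Nonempty A] (hH : 0 < H) :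
    M.dualLowerBound ρ ∈ Set.Ioc 0 (1 / 2) := by
  have : Nonempty (Fin H) := ⟨⟨0, hH⟩⟩
  obtain ⟨⟨h, s, a⟩, hmin⟩ := exists_eq_ciInf_of_finite (f := fun i : Fin H × S × A =>
    if 0 < M.optDual ρ i.1 i.2.1 i.2.2 ∧ M.optDual ρ i.1 i.2.1 i.2.2 < 1
    then M.optDual ρ i.1 i.2.1 i.2.2 / 2 else 1 / 2)
  rw [MDP.dualLowerBound, ← hmin]
  dsimp only
  split_ifs with hopt
  · exact ⟨by linarith, by linarith⟩
  · norm_num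

theorem exists_forall_isStabilityRadius [Finite A] [Nonempty S] [Nonempty A] (hH : 0 < H)
    (hρ : 0 < ρ) :
    ∃ η₀ > 0, ∀ h s a, IsStabilityRadius (M.trans h s a) ρ (M.optRobustValue ρ h.succ)
      (H / ρ * Real.exp (H / M.dualLowerBound ρ)) η₀ := by
  have : Nonempty (Fin H) := ⟨⟨0, hH⟩⟩
  choose η hη hstable using fun i : Fin H × S × A =>
    exists_isStabilityRadius (M.trans_mem i.1 i.2.1 i.2.2) hρ (Nat.cast_pos.2 hH)
      (optRobustValue_mem_Icc M hρ i.1.succ) (dualLowerBound_mem_Ioc M (ρ := ρ) hH).1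
      (optDual_eq_zero_or_dualLowerBound_lt M hρ i.1 i.2.1 i.2.2)
  obtain ⟨i₀, hmin⟩ := Finite.exists_min η
  exact ⟨η i₀, hη i₀, fun h s a => (hstable (h, s, a)).anti (hmin (h, s, a))⟩

end DualLowerBound

section Hoeffding

variable {Ω ι : Type*} [MeasurableSpace Ω] {μ : Measure Ω} [IsProbabilityMeasure μ] [Fintype ι]
  {Z : ι → Ω → ℝ} {a b m η : ℝ}

theorem measureReal_mul_le_sum_sub_le (hind : iIndepFun Z μ) (hZ : ∀ i, AEMeasurable (Z i) μ)
    (hmem : ∀ i, ∀ᵐ ω ∂μ, Z i ω ∈ Set.Icc a b) (hm : ∀ i, ∫ ω, Z i ω ∂μ = m) (hη : 0 ≤ η) :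
    μ.real {ω | Fintype.card ι * η ≤ ∑ i, (Z i ω - m)} ≤
      Real.exp (-2 * Fintype.card ι * η ^ 2 / (b - a) ^ 2) := by
  have hsub : ∀ i, HasSubgaussianMGF (fun ω => Z i ω - m) ((‖b - a‖₊ / 2) ^ 2) μ := fun i =>
    hm i ▸ hasSubgaussianMGF_of_mem_Icc (hZ i) (hmem i)
  have hind' : iIndepFun (fun i ω => Z i ω - m) μ :=
    hind.comp (fun _ x => x - m) fun _ => measurable_id.sub_const m
  refine (HasSubgaussianMGF.measure_sum_ge_le_of_iIndepFun hind' (s := Finset.univ)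
    (fun i _ => hsub i) (by positivity)).trans_eq (congrArg Real.exp ?_)
  simp only [Finset.sum_const, Finset.card_univ, nsmul_eq_mul, NNReal.coe_mul, NNReal.coe_natCast,
    NNReal.coe_pow, NNReal.coe_div, coe_nnnorm, NNReal.coe_ofNat, div_pow, Real.norm_eq_abs, sq_abs]
  rcases eq_or_ne (b - a) 0 with h | h
  · simp [h]
  rcases eq_or_ne (Fintype.card ι : ℝ) 0 with h' | h'
  · simp [h']
  field

theorem measureReal_lt_abs_sum_div_card_sub_le [Nonempty ι] (hind : iIndepFun Z μ)
    (hZ : ∀ i, AEMeasurable (Z i) μ) (hmem : ∀ i, ∀ᵐ ω ∂μ, Z i ω ∈ Set.Icc a b)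
    (hm : ∀ i, ∫ ω, Z i ω ∂μ = m) (hη : 0 ≤ η) :
    μ.real {ω | η < |(∑ i, Z i ω) / Fintype.card ι - m|} ≤
      2 * Real.exp (-2 * Fintype.card ι * η ^ 2 / (b - a) ^ 2) := by
  have hcard : (0 : ℝ) < Fintype.card ι := Nat.cast_pos.2 Fintype.card_pos
  have hupper := measureReal_mul_le_sum_sub_le hind hZ hmem hm hη
  have hlower := measureReal_mul_le_sum_sub_le (Z := fun i ω => -Z i ω) (m := -m) (a := -b)
    (b := -a) (hind.comp (fun _ x => -x) fun _ => measurable_neg) (fun i => (hZ i).neg)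
    (fun i => (hmem i).mono fun ω h => ⟨neg_le_neg h.2, neg_le_neg h.1⟩)
    (fun i => by rw [integral_neg, hm]) hη
  rw [neg_sub_neg] at hlower
  rw [two_mul]
  refine (measureReal_mono fun ω hω => ?_).trans
    ((measureReal_union_le _ _).trans (add_le_add hupper hlower))
  have hsum : ∑ i, (Z i ω - m) = Fintype.card ι * ((∑ i, Z i ω) / Fintype.card ι - m) := by
    rw [Finset.sum_sub_distrib, Finset.sum_const, Finset.card_univ, nsmul_eq_mul, mul_sub,
      mul_div_cancel₀ _ hcard.ne']
  simp only [Set.mem_union, Set.mem_ofPred_eq, neg_sub_neg, ← neg_sub (Z _ _),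
    Finset.sum_neg_distrib, hsum, ← mul_neg, mul_le_mul_iff_right₀ hcard]
  exact (lt_abs.1 hω).imp le_of_lt le_of_lt

end Hoeffding

section Frequencies

/-- The empirical distribution of a sample: the proportion of its entries equal to a point. -/
def relativeFrequency {S : Type*} [DecidableEq S] {N : ℕ} (z : Fin N → S) (s : S) : ℝ :=
  (Finset.card {i : Fin N | z i = s} : ℝ) / N

variable {S : Type*} [DecidableEq S] {N : ℕ}

theorem sum_relativeFrequency (z : Fin N → S) (T : Finset S) :
    ∑ s ∈ T, relativeFrequency z s = (∑ i, if z i ∈ T then (1 : ℝ) else 0) / N := by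
  simp only [relativeFrequency, ← Finset.sum_div, Finset.natCast_card_filter]
  rw [Finset.sum_comm]
  simp only [Finset.sum_ite_eq]

theorem relativeFrequency_mem_stdSimplex [Fintype S] (hN : 0 < N) (z : Fin N → S) :
    relativeFrequency z ∈ stdSimplex ℝ S := by
  refine ⟨fun s => div_nonneg (Nat.cast_nonneg _) (Nat.cast_nonneg _), ?_⟩
  simp [sum_relativeFrequency, hN.ne']

theorem relativeFrequency_eq_zero {z : Fin N → S} {s : S} (h : ∀ i, z i ≠ s) :
    relativeFrequency z s = 0 := by
  simp [relativeFrequency, h]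

theorem measureReal_lt_abs_sum_relativeFrequency_sub_le [MeasurableSpace S]
    [MeasurableSingletonClass S] {Ω : Type*} [MeasurableSpace Ω] {μ : Measure Ω}
    [IsProbabilityMeasure μ] {Z : Fin N → Ω → S} (hind : iIndepFun Z μ)
    (hZ : ∀ i, Measurable (Z i)) {p : S → ℝ} (hp : ∀ i s, μ.real {ω | Z i ω = s} = p s)
    (hN : 0 < N) (T : Finset S) {η : ℝ} (hη : 0 ≤ η) :
    μ.real {ω | η < |∑ s ∈ T, relativeFrequency (fun i => Z i ω) s - ∑ s ∈ T, p s|} ≤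
      2 * Real.exp (-2 * N * η ^ 2) := by
  have : Nonempty (Fin N) := ⟨⟨0, hN⟩⟩
  have hg : Measurable fun s => if s ∈ T then (1 : ℝ) else 0 :=
    Measurable.ite T.measurableSet measurable_const measurable_const
  have hmean : ∀ i, ∫ ω, (if Z i ω ∈ T then (1 : ℝ) else 0) ∂μ = ∑ s ∈ T, p s := fun i => by
    have hind : (fun ω => if Z i ω ∈ T then (1 : ℝ) else 0) = (Z i ⁻¹' T).indicator 1 := by
      funext ω
      simp [Set.indicator]
    rw [hind, integral_indicator_one (hZ i T.measurableSet),
      ← sum_measureReal_preimage_singleton T fun s _ => hZ i (measurableSet_singleton s)]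
    exact Finset.sum_congr rfl fun s _ => hp i s
  simpa [sum_relativeFrequency] using measureReal_lt_abs_sum_div_card_sub_le (a := 0) (b := 1)
    (Z := fun i ω => if Z i ω ∈ T then 1 else 0) (hind.comp _ fun _ => hg)
    (fun i => (hg.comp (hZ i)).aemeasurable)
    (fun i => .of_forall fun ω => by split_ifs <;> simp) hmean hη

end Frequencies

section Concentration

theorem measureReal_prodMk_mem_le_of_indepFun {Ω α β : Type*} [MeasurableSpace Ω]
    [MeasurableSpace α] [MeasurableSpace β] {μ : Measure Ω} [IsProbabilityMeasure μ]
    {Y : Ω → α} {Z : Ω → β} (hind : IndepFun Y Z μ) (hY : AEMeasurable Y μ)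
    (hZ : AEMeasurable Z μ) {R : Set (α × β)} (hR : MeasurableSet R) {c : ℝ}
    (h : ∀ y, μ.real {ω | (y, Z ω) ∈ R} ≤ c) : μ.real {ω | (Y ω, Z ω) ∈ R} ≤ c := by
  have := Measure.isProbabilityMeasure_map hY
  have hsection : ∀ y, μ.map Z (Prod.mk y ⁻¹' R) ≤ ENNReal.ofReal c := fun y => by
    rw [Measure.map_apply_of_aemeasurable hZ (measurable_prodMk_left hR),
      ← ofReal_measureReal]
    exact ENNReal.ofReal_le_ofReal (h y)
  refine ENNReal.toReal_le_of_le_ofReal (measureReal_nonneg.trans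
    (h (Nonempty.some (nonempty_of_isProbabilityMeasure (μ.map Y))))) ?_
  calc μ {ω | (Y ω, Z ω) ∈ R} = μ.map (fun ω => (Y ω, Z ω)) R :=
        (Measure.map_apply_of_aemeasurable (hY.prodMk hZ) hR).symm
    _ = ∫⁻ y, μ.map Z (Prod.mk y ⁻¹' R) ∂μ.map Y := by
        rw [(indepFun_iff_map_prod_eq_prod_map_map hY hZ).1 hind, Measure.prod_apply hR]
    _ ≤ ∫⁻ _, ENNReal.ofReal c ∂μ.map Y := lintegral_mono hsection
    _ = ENNReal.ofReal c := by rw [lintegral_const, measure_univ, mul_one]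

variable {S A : Type*} {H N : ℕ}

/-- The samples of `D` at times after `h`, as a data set whose other entries are all `s₀`. -/
def laterData (h : Fin H) (s₀ : S) (D : Dataset S A H N) : Dataset S A H N :=
  fun t => if h < t then D t else fun _ _ _ => s₀

theorem laterData_apply_of_lt {h t : Fin H} (ht : h < t) (s₀ : S) (D : Dataset S A H N) :
    laterData h s₀ D t = D t :=
  if_pos ht

variable [Fintype S]

theorem rpvlValue_congr [DecidableEq S] (r : Fin H → S → A → ℝ) (ρ : ℝ) {D D' : Dataset S A H N}
    (k : Fin (H + 1)) (hD : ∀ t : Fin H, k ≤ t.castSucc → D t = D' t) :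
    rpvlValue r ρ D k = rpvlValue r ρ D' k := by
  rw [rpvlValue_eq_backwardIterate, rpvlValue_eq_backwardIterate]
  induction k using Fin.reverseInduction with
  | last => simp only [backwardIterate_last]
  | cast h ih =>
    have hemp : ∀ s a, empirical D h s a = empirical D' h s a := fun s a => by
      funext s'
      simp only [empirical, hD h le_rfl]
    rw [backwardIterate_castSucc, backwardIterate_castSucc,
      ih fun t ht => hD t (h.castSucc_lt_succ.le.trans ht)]
    funext s
    simp only [optimalityOperator, robustActionValue, hemp]

variable {Ω : Type*} [MeasurableSpace Ω] [MeasurableSpace S] {μ : Measure Ω}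
  {M : MDP S A H} {X : Ω → Dataset S A H N}

theorem IsGenerativeSample.indepFun_laterData [Finite A]
    [MeasurableSingletonClass S] (hX : IsGenerativeSample M μ X) (h : Fin H) (s₀ s : S) (a : A) :
    IndepFun (fun ω => laterData h s₀ (X ω)) (fun ω => X ω h s a) μ := by
  classical
  have := Fintype.ofFinite A
  let I : Finset (Fin H × S × A × Fin N) := {j | h < j.1}
  let J : Finset (Fin H × S × A × Fin N) := {j | j.1 = h}
  have hIJ : Disjoint I J := Finset.disjoint_filter.2 fun j _ hj => hj.ne'
  let φ : (I → S) → Dataset S A H N := fun z t s a i =>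
    if ht : h < t then z ⟨(t, s, a, i), by simpa [I] using ht⟩ else s₀
  let ψ : (J → S) → Fin N → S := fun z i => z ⟨(h, s, a, i), by simp [J]⟩
  convert (hX.indep.indepFun_finset I J hIJ fun j => hX.measurable _ _ _ _).comp
    (φ := φ) (ψ := ψ) (measurable_of_finite φ) (measurable_of_finite ψ) using 1
  · funext ω t s a i
    by_cases ht : h < t <;> simp [laterData, φ, ht]
  · rfl

variable [DecidableEq S] [IsProbabilityMeasure μ]

theorem IsGenerativeSample.ae_empirical_eq_zero [Finite A] (hX : IsGenerativeSample M μ X) :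
    ∀ᵐ ω ∂μ, ∀ h s a s', M.trans h s a s' = 0 → empirical (X ω) h s a s' = 0 := by
  simp only [ae_all_iff]
  intro h s a s' h0
  have hne : ∀ i, ∀ᵐ ω ∂μ, X ω h s a i ≠ s' := fun i =>
    ae_iff.2 (by simpa [h0, measureReal_eq_zero_iff] using hX.law h s a i s')
  filter_upwards [ae_all_iff.2 hne] with ω hω using relativeFrequency_eq_zero hω

variable [MeasurableSingletonClass S]

theorem IsGenerativeSample.measureReal_lt_abs_empirical_sub_le [Finite A]
    (hX : IsGenerativeSample M μ X) (hN : 0 < N) (h : Fin H) (s : S) (a : A)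
    {T : Dataset S A H N → Finset S} (hT : ∀ D D', (∀ t, h < t → D t = D' t) → T D = T D')
    {η : ℝ} (hη : 0 ≤ η) :
    μ.real {ω | η < |∑ s' ∈ T (X ω), empirical (X ω) h s a s' -
      ∑ s' ∈ T (X ω), M.trans h s a s'|} ≤ 2 * Real.exp (-2 * N * η ^ 2) := by
  have hlater : ∀ ω, T (X ω) = T (laterData h s (X ω)) := fun ω =>
    hT _ _ fun t ht => (laterData_apply_of_lt ht s (X ω)).symm
  simp only [hlater]
  have hmeas : Measurable X := by
    simpa only [measurable_pi_iff] using hX.measurable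
  exact measureReal_prodMk_mem_le_of_indepFun (hX.indepFun_laterData h s s a)
    ((measurable_of_finite (laterData h s)).comp hmeas).aemeasurable
    (measurable_pi_lambda _ (hX.measurable h s a)).aemeasurable
    (R := {x | η < |∑ s' ∈ T x.1, relativeFrequency x.2 s' - ∑ s' ∈ T x.1, M.trans h s a s'|})
    (Set.toFinite _).measurableSet fun D => measureReal_lt_abs_sum_relativeFrequency_sub_le
      (hX.indep.precomp (g := fun i : Fin N => (h, s, a, i)) fun i j hij => by simpa using hij)
      (hX.measurable h s a) (hX.law h s a) hN (T D) hη

theorem IsGenerativeSample.measureReal_not_sublevelClose_le [Fintype A]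
    (hX : IsGenerativeSample M μ X) (hN : 0 < N) {V : Dataset S A H N → Fin H → S → ℝ}
    (hV : ∀ h D D', (∀ t, h < t → D t = D' t) → V D h = V D' h) {η : ℝ} (hη : 0 ≤ η) :
    μ.real {ω | ∃ h s a, ¬SublevelClose (M.trans h s a) (empirical (X ω) h s a) (V (X ω) h) η} ≤
      H * Fintype.card S ^ 2 * Fintype.card A * (2 * Real.exp (-2 * N * η ^ 2)) := by
  let E : Fin H × S × A × S → Set Ω := fun ⟨h, s, a, s₀⟩ =>
    {ω | η < |∑ s' with V (X ω) h s' ≤ V (X ω) h s₀, empirical (X ω) h s a s' -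
      ∑ s' with V (X ω) h s' ≤ V (X ω) h s₀, M.trans h s a s'|}
  have hcover : {ω | ∃ h s a, ¬SublevelClose (M.trans h s a) (empirical (X ω) h s a)
      (V (X ω) h) η} ⊆ ⋃ j, E j := by
    rintro ω ⟨h, s, a, hclose⟩
    obtain ⟨s₀, hs₀⟩ := not_forall.1 hclose
    exact Set.mem_iUnion.2 ⟨(h, s, a, s₀), not_le.1 hs₀⟩
  calc _ ≤ μ.real (⋃ j, E j) := measureReal_mono hcover
    _ ≤ ∑ j, μ.real (E j) := measureReal_iUnion_fintype_le _
    _ ≤ ∑ _j : Fin H × S × A × S, 2 * Real.exp (-2 * N * η ^ 2) :=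
      Finset.sum_le_sum fun ⟨h, s, a, s₀⟩ _ => hX.measureReal_lt_abs_empirical_sub_le hN h s a
        (T := fun D => {s' | V D h s' ≤ V D h s₀}) (fun D D' hD => by simp only [hV h D D' hD]) hη
    _ = _ := by
      rw [Finset.sum_const, Finset.card_univ, nsmul_eq_mul]
      simp only [Fintype.card_prod, Fintype.card_fin]
      push_cast
      ring

end Concentration

section SampleSize

variable {nS nA H N : ℕ} {ρ ε δ lam G : ℝ}

theorem log_div_mul_pos (hS : 0 < nS) (hA : 0 < nA) (hH : 0 < H) (hδ : δ ∈ Set.Ioo (0 : ℝ) 1)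
    (hlam : lam ∈ Set.Ioo (0 : ℝ) 1) : 0 < Real.log (8 * H * nS * nA / (lam * δ)) := by
  have hcard : (1 : ℝ) ≤ 8 * H * nS * nA := by
    exact_mod_cast (by positivity : 0 < 8 * H * nS * nA)
  refine Real.log_pos ((one_lt_div (mul_pos hlam.1 hδ.1)).2 (lt_of_lt_of_le ?_ hcard))
  exact mul_lt_one_of_nonneg_of_lt_one_left hlam.1.le hlam.2 hδ.2.le

theorem pos_of_sampleSizeKL_le (hS : 0 < nS) (hA : 0 < nA) (hH : 0 < H) (hρ : 0 < ρ) (hε : 0 < ε)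
    (hδ : δ ∈ Set.Ioo (0 : ℝ) 1) (hlam : lam ∈ Set.Ioo (0 : ℝ) 1)
    (h : sampleSizeKL nS nA H ρ ε δ lam ≤ (N : ℝ) * nS * nA * H) : 0 < N := by
  have hlog := log_div_mul_pos hS hA hH hδ hlam
  have hpos : 0 < sampleSizeKL nS nA H ρ ε δ lam := by rw [sampleSizeKL]; positivity
  refine Nat.pos_of_ne_zero fun hN => hpos.not_ge ?_
  simpa [hN] using h

theorem two_mul_log_le_of_sampleSizeKL_le (hS : 0 < nS) (hA : 0 < nA) (hH : 0 < H) (hρ : 0 < ρ)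
    (hε : 0 < ε) (hδ : δ ∈ Set.Ioo (0 : ℝ) 1) (hlam : lam ∈ Set.Ioo (0 : ℝ) 1) (hG : 0 < G)
    (hGH : G ^ 2 ≤ 2 * Real.exp (H / lam) * H ^ 4)
    (h : sampleSizeKL nS nA H ρ ε δ lam ≤ (N : ℝ) * nS * nA * H) :
    2 * Real.log (8 * H * nS * nA / (lam * δ)) ≤
      2 * N * (ε * ρ / (G * Real.exp (H / lam))) ^ 2 := by
  have hlog := log_div_mul_pos hS hA hH hδ hlam
  have hexp : Real.exp (3 * H / lam) = Real.exp (H / lam) ^ 3 := by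
    rw [← Real.exp_nat_mul, mul_div_assoc, Nat.cast_ofNat]
  rw [sampleSizeKL, hexp] at h
  set L := Real.log (8 * H * nS * nA / (lam * δ))
  set E := Real.exp (H / lam)
  have : 0 < E := Real.exp_pos _
  have hN : 2 * E ^ 3 * H ^ 4 / (ρ ^ 2 * ε ^ 2) * L ≤ N := by
    have hcard : (0 : ℝ) < nS * nA * H := by positivity
    refine le_of_mul_le_mul_right (le_of_eq_of_le ?_ (h.trans_eq ?_)) hcard <;> ring
  calc 2 * L ≤ 2 * L * (2 * E * H ^ 4 / G ^ 2) :=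
        le_mul_of_one_le_right (by positivity) ((one_le_div (by positivity)).2 hGH)
    _ = 2 * (2 * E ^ 3 * H ^ 4 / (ρ ^ 2 * ε ^ 2) * L) * (ε * ρ / (G * E)) ^ 2 := by field
    _ ≤ 2 * N * (ε * ρ / (G * E)) ^ 2 := by gcongr

theorem mul_two_mul_exp_le_of_sampleSizeKL_le (hS : 0 < nS) (hA : 0 < nA) (hH : 0 < H)
    (hρ : 0 < ρ) (hε : 0 < ε) (hδ : δ ∈ Set.Ioo (0 : ℝ) 1) (hlam : lam ∈ Set.Ioo (0 : ℝ) 1)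
    (hG : 0 < G) (hGH : G ^ 2 ≤ 2 * Real.exp (H / lam) * H ^ 4)
    (h : sampleSizeKL nS nA H ρ ε δ lam ≤ (N : ℝ) * nS * nA * H) :
    H * nS ^ 2 * nA * (2 * Real.exp (-2 * N * (ε * ρ / (G * Real.exp (H / lam))) ^ 2)) ≤
      δ / 2 := by
  have hlog := two_mul_log_le_of_sampleSizeKL_le hS hA hH hρ hε hδ hlam hG hGH h
  obtain ⟨hδ0, hδ1⟩ := hδ
  obtain ⟨hlam0, hlam1⟩ := hlam
  have hsq : Real.exp (-2 * N * (ε * ρ / (G * Real.exp (H / lam))) ^ 2) ≤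
      (lam * δ / (8 * H * nS * nA)) ^ 2 := by
    calc _ ≤ Real.exp (-(2 * Real.log (8 * H * nS * nA / (lam * δ)))) :=
          Real.exp_le_exp.2 (by linarith)
      _ = (lam * δ / (8 * H * nS * nA)) ^ 2 := by
          rw [← mul_neg, ← Real.log_inv, inv_div, ← Nat.cast_ofNat, Real.exp_nat_mul,
            Real.exp_log (by positivity)]
  have hHA : (1 : ℝ) ≤ H * nA := by exact_mod_cast Nat.mul_pos hH hA
  calc _ ≤ H * nS ^ 2 * nA * (2 * (lam * δ / (8 * H * nS * nA)) ^ 2) := by gcongr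
    _ = lam ^ 2 * δ * δ / (32 * (H * nA)) := by field_simp; norm_num
    _ ≤ 1 * δ / (2 * 1) := by
        have hle : lam ^ 2 * δ ≤ 1 :=
          mul_le_one₀ (pow_le_one₀ hlam0.le hlam1.le) hδ0.le hδ1.le
        gcongr
        norm_num
    _ = δ / 2 := by ring

theorem exists_forall_mul_two_mul_exp_le {C η : ℝ} (hη : 0 < η) (hδ : 0 < δ) :
    ∃ N₀ : ℕ, ∀ N : ℕ, N₀ ≤ N → C * (2 * Real.exp (-2 * N * η ^ 2)) ≤ δ := by
  have hlim : Filter.Tendsto (fun N : ℕ => C * (2 * Real.exp (-2 * N * η ^ 2))) Filter.atTop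
      (nhds (C * (2 * 0))) := by
    refine ((Real.tendsto_exp_atBot.comp ?_).const_mul 2).const_mul C
    simp only [mul_right_comm _ _ (η ^ 2)]
    exact tendsto_natCast_atTop_atTop.const_mul_atTop_of_neg (by nlinarith)
  simp only [mul_zero] at hlim
  exact Filter.eventually_atTop.1 (hlim.eventually_le_const hδ)

theorem two_le_exp_div (hH : 0 < H) (hlam : lam ∈ Set.Ioo (0 : ℝ) 1) :
    2 ≤ Real.exp (H / lam) := by
  have hdiv : 1 ≤ (H : ℝ) / lam :=
    (one_le_div hlam.1).2 (hlam.2.le.trans (Nat.one_le_cast.2 hH))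
  linarith [Real.add_one_le_exp ((H : ℝ) / lam)]

theorem two_mul_sq_le_exp_div (hlam : lam ∈ Set.Ioc (0 : ℝ) (1 / 2)) :
    2 * (H : ℝ) ^ 2 ≤ Real.exp (H / lam) := by
  have hdiv : 2 * (H : ℝ) ≤ H / lam := by
    rw [le_div_iff₀ hlam.1]
    nlinarith [hlam.2, Nat.cast_nonneg (α := ℝ) H]
  calc 2 * (H : ℝ) ^ 2 ≤ 1 + 2 * H + (2 * H) ^ 2 / 2 := by nlinarith
    _ ≤ Real.exp (2 * H) := Real.quadratic_le_exp_of_nonneg (by positivity)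
    _ ≤ Real.exp (H / lam) := Real.exp_le_exp.2 hdiv

end SampleSize

section SuboptimalityGap

variable {S A : Type*} [Fintype S] [DecidableEq S] [Finite A] [Nonempty A] {H N : ℕ}
  {M : MDP S A H} {D : Dataset S A H N} {π : Policy S A H} {ρ η lam : ℝ}

theorem dist_optRobustValue_robustValue_le_of_dualsBoundedBelow (hρ : 0 < ρ) (hN : 0 < N)
    (hη : 0 ≤ η) (hlam : 0 < lam)
    (hclose : ∀ h s a, SublevelClose (M.trans h s a) (empirical D h s a)
      (rpvlValue M.reward ρ D h.succ) η)
    (hdual : M.DualsBoundedBelow ρ lam D) (hπ : IsRPVLOutput M.reward ρ D π) :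
    dist (M.optRobustValue ρ 0) (M.robustValue ρ π 0) ≤
      2 * H * (H / ρ * Real.exp (H / lam) * η) := by
  have hD : ∀ h s a, empirical D h s a ∈ stdSimplex ℝ S := fun h s a =>
    relativeFrequency_mem_stdSimplex hN (D h s a)
  have he : 0 ≤ H / ρ * Real.exp (H / lam) * η := by positivity
  have hgap := dist_optRobustValue_robustValue_le M hρ hπ he (fun h s a => ?_) 0
  · simpa using hgap
  · rw [dist_comm]
    rcases hdual h s a with heq | ⟨hnom, hemp⟩
    · rwa [heq, dist_self]
    · exact (hclose h s a).dist_worstCase_le (M.trans_mem h s a) (hD h s a) hρ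
        (rpvlValue_mem_Icc M hρ.le hD h.succ) hη hlam hnom hemp

theorem dist_optRobustValue_robustValue_le_of_isStabilityRadius {C η₀ : ℝ} (hρ : 0 < ρ)
    (hN : 0 < N) (hC : 0 ≤ C) (hη : 0 ≤ η) (hη₀ : 0 ≤ η₀)
    (hstab : ∀ h s a, IsStabilityRadius (M.trans h s a) ρ (M.optRobustValue ρ h.succ) C η₀)
    (hsupp : ∀ h s a s', M.trans h s a s' = 0 → empirical D h s a s' = 0)
    (hclose : ∀ h s a, SublevelClose (M.trans h s a) (empirical D h s a)
      (M.optRobustValue ρ h.succ) (min η η₀))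
    (hπ : IsRPVLOutput M.reward ρ D π) :
    dist (M.optRobustValue ρ 0) (M.robustValue ρ π 0) ≤ 2 * H ^ 2 * (C * η) := by
  have hD : ∀ h s a, empirical D h s a ∈ stdSimplex ℝ S := fun h s a =>
    relativeFrequency_mem_stdSimplex hN (D h s a)
  refine dist_optRobustValue_robustValue_le_of_optimal M hρ hD hπ (by positivity) fun h s a => ?_
  calc _ ≤ C * min η η₀ := hstab h s a _ (hD h s a) (hsupp h s a) _
        ⟨le_min hη hη₀, min_le_right _ _⟩ (hclose h s a)
    _ ≤ C * η := by gcongr; exact min_le_left _ _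

end SuboptimalityGap

section HighProbability

theorem one_sub_le_measureReal_of_ae {Ω : Type*} [MeasurableSpace Ω] {μ : Measure Ω}
    [IsProbabilityMeasure μ] {bad good : Set Ω} {δ : ℝ} (h : ∀ᵐ ω ∂μ, ω ∉ bad → ω ∈ good)
    (hbad : μ.real bad ≤ δ) : 1 - δ ≤ μ.real good := by
  have hcover : μ.real (bad ∪ good) = 1 := by
    rw [← probReal_univ (μ := μ)]
    refine measureReal_congr (Filter.eventuallyEq_univ.2 ?_)
    filter_upwards [h] with ω hω
    exact or_iff_not_imp_left.2 hω
  linarith [measureReal_union_le (μ := μ) bad good]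

variable {S A : Type*} [Fintype S] [DecidableEq S] [MeasurableSpace S]
  [MeasurableSingletonClass S] [Fintype A] [Nonempty A] {H N : ℕ} {M : MDP S A H}
  {ρ ε δ lam : ℝ} {Ω : Type*} [MeasurableSpace Ω] {μ : Measure Ω} [IsProbabilityMeasure μ]
  {X : Ω → Dataset S A H N}

theorem IsGenerativeSample.one_sub_le_measureReal_of_isStabilityRadius
    (hX : IsGenerativeSample M μ X) {η η₀ C : ℝ} (hρ : 0 < ρ) (hNpos : 0 < N) (hC : 0 ≤ C)
    (hη : 0 ≤ η) (hη₀ : 0 ≤ η₀)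
    (hstab : ∀ h s a, IsStabilityRadius (M.trans h s a) ρ (M.optRobustValue ρ h.succ) C η₀)
    (hboundη : H * Fintype.card S ^ 2 * Fintype.card A * (2 * Real.exp (-2 * N * η ^ 2)) ≤ δ / 2)
    (hboundη₀ : H * Fintype.card S ^ 2 * Fintype.card A * (2 * Real.exp (-2 * N * η₀ ^ 2)) ≤
      δ / 2) :
    1 - δ ≤ μ.real {ω | ∀ π : Policy S A H, IsRPVLOutput M.reward ρ (X ω) π →
      ‖M.optRobustValue ρ 0 - M.robustValue ρ π 0‖ ≤ 2 * H ^ 2 * (C * η)} := by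
  let bad (η : ℝ) : Set Ω := {ω | ∃ h s a,
    ¬SublevelClose (M.trans h s a) (empirical (X ω) h s a) (M.optRobustValue ρ h.succ) η}
  have hbad : ∀ η, 0 ≤ η → μ.real (bad η) ≤
      H * Fintype.card S ^ 2 * Fintype.card A * (2 * Real.exp (-2 * N * η ^ 2)) := fun η hη =>
    hX.measureReal_not_sublevelClose_le hNpos (V := fun _ h => M.optRobustValue ρ h.succ)
      (fun _ _ _ _ => rfl) hη
  refine one_sub_le_measureReal_of_ae (bad := bad η ∪ bad η₀) ?_ ?_
  · filter_upwards [hX.ae_empirical_eq_zero] with ω hsupp hω π hπ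
    have hclose := not_or.1 hω
    simp only [bad, Set.mem_ofPred_eq, not_exists, not_not] at hclose
    rw [← dist_eq_norm]
    exact dist_optRobustValue_robustValue_le_of_isStabilityRadius hρ hNpos hC hη hη₀ hstab hsupp
      (fun h s a s' => le_min (hclose.1 h s a s') (hclose.2 h s a s')) hπ
  · linarith [measureReal_union_le (μ := μ) (bad η) (bad η₀), hbad η hη, hbad η₀ hη₀]

variable [Nonempty S]

theorem IsGenerativeSample.measureReal_dualsBoundedBelow_and_lt_norm_le
    (hX : IsGenerativeSample M μ X) (hρ : 0 < ρ) (hδ : δ ∈ Set.Ioo (0 : ℝ) 1)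
    (hlam : lam ∈ Set.Ioo (0 : ℝ) 1) (hH : 0 < H) (hε : 0 < ε)
    (hN : sampleSizeKL (Fintype.card S) (Fintype.card A) H ρ ε δ lam ≤
      (N : ℝ) * Fintype.card S * Fintype.card A * H) :
    μ.real {ω | M.DualsBoundedBelow ρ lam (X ω) ∧
      ∃ π : Policy S A H, IsRPVLOutput M.reward ρ (X ω) π ∧
        ε < ‖M.optRobustValue ρ 0 - M.robustValue ρ π 0‖} ≤ δ / 2 := by
  have hNpos := pos_of_sampleSizeKL_le Fintype.card_pos Fintype.card_pos hH hρ hε hδ hlam hN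
  set η := ε * ρ / (2 * H ^ 2 * Real.exp (H / lam)) with hη
  have hη0 : 0 ≤ η := by positivity
  have hgap : 2 * H * (H / ρ * Real.exp (H / lam) * η) = ε := by rw [hη]; field
  have hsize : (2 * H ^ 2 : ℝ) ^ 2 ≤ 2 * Real.exp (H / lam) * H ^ 4 := by
    calc (2 * H ^ 2 : ℝ) ^ 2 = 2 * 2 * H ^ 4 := by ring
      _ ≤ 2 * Real.exp (H / lam) * H ^ 4 := by gcongr; exact two_le_exp_div hH hlam
  calc _ ≤ μ.real {ω | ∃ h s a, ¬SublevelClose (M.trans h s a) (empirical (X ω) h s a)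
        (rpvlValue M.reward ρ (X ω) h.succ) η} := by
        refine measureReal_mono fun ω ⟨hdual, π, hπ, hlt⟩ => ?_
        by_contra! hclose
        refine hlt.not_ge ?_
        rw [← dist_eq_norm, ← hgap]
        exact dist_optRobustValue_robustValue_le_of_dualsBoundedBelow hρ hNpos hη0 hlam.1
          (by simpa using hclose) hdual hπ
    _ ≤ _ := hX.measureReal_not_sublevelClose_le hNpos
        (V := fun D h => rpvlValue M.reward ρ D h.succ)
        (fun h _ _ hD => rpvlValue_congr M.reward ρ h.succ fun t ht =>
          hD t (Fin.succ_le_castSucc_iff.1 ht)) hη0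
    _ ≤ δ / 2 := mul_two_mul_exp_le_of_sampleSizeKL_le Fintype.card_pos Fintype.card_pos hH hρ hε
        hδ hlam (by positivity) hsize hN

theorem IsGenerativeSample.one_sub_le_measureReal_norm_le (hX : IsGenerativeSample M μ X)
    {η₀ : ℝ} (hρ : 0 < ρ) (hδ : δ ∈ Set.Ioo (0 : ℝ) 1) (hH : 0 < H) (hε : 0 < ε)
    (hlam : lam ∈ Set.Ioc (0 : ℝ) (1 / 2)) (hη₀ : 0 ≤ η₀)
    (hstab : ∀ h s a, IsStabilityRadius (M.trans h s a) ρ (M.optRobustValue ρ h.succ)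
      (H / ρ * Real.exp (H / lam)) η₀)
    (hbound : H * Fintype.card S ^ 2 * Fintype.card A * (2 * Real.exp (-2 * N * η₀ ^ 2)) ≤ δ / 2)
    (hN : sampleSizeKL (Fintype.card S) (Fintype.card A) H ρ ε δ lam ≤
      (N : ℝ) * Fintype.card S * Fintype.card A * H) :
    1 - δ ≤ μ.real {ω | ∀ π : Policy S A H, IsRPVLOutput M.reward ρ (X ω) π →
      ‖M.optRobustValue ρ 0 - M.robustValue ρ π 0‖ ≤ ε} := by
  have hlam1 : lam ∈ Set.Ioo (0 : ℝ) 1 := ⟨hlam.1, hlam.2.trans_lt one_half_lt_one⟩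
  have hNpos := pos_of_sampleSizeKL_le Fintype.card_pos Fintype.card_pos hH hρ hε hδ hlam1 hN
  set η := ε * ρ / (2 * H ^ 3 * Real.exp (H / lam)) with hη
  have hη0 : 0 ≤ η := by positivity
  have hgap : 2 * H ^ 2 * (H / ρ * Real.exp (H / lam) * η) = ε := by rw [hη]; field
  have hsize : (2 * H ^ 3 : ℝ) ^ 2 ≤ 2 * Real.exp (H / lam) * H ^ 4 := by
    calc (2 * H ^ 3 : ℝ) ^ 2 = 2 * (2 * H ^ 2) * H ^ 4 := by ring
      _ ≤ 2 * Real.exp (H / lam) * H ^ 4 := by gcongr; exact two_mul_sq_le_exp_div hlam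
  have hboundη := mul_two_mul_exp_le_of_sampleSizeKL_le Fintype.card_pos Fintype.card_pos hH hρ hε
    hδ hlam1 (by positivity) hsize hN
  rw [← hgap]
  exact hX.one_sub_le_measureReal_of_isStabilityRadius hρ hNpos (by positivity) hη0 hη₀ hstab
    hboundη hbound

end HighProbability

end RobustRL

end

open RobustRL in
theorem theorem3 {S A : Type*} [Fintype S] [Nonempty S] [DecidableEq S] [MeasurableSpace S]
    [MeasurableSingletonClass S] [Fintype A] [Nonempty A] {H : ℕ} (M : MDP S A H)
    (ρ : ℝ) (hρ : 0 < ρ) (δ : ℝ) (hδ : δ ∈ Set.Ioo (0 : ℝ) 1) :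
    -- the sample complexity bound, for `N` above a threshold that does not depend on `ε`
    (∃ N₀ : ℕ, ∀ ε ∈ Set.Ioo (0 : ℝ) H, ∀ N : ℕ, N₀ ≤ N →
      sampleSizeKL (Fintype.card S) (Fintype.card A) H ρ ε δ (M.dualLowerBound ρ) ≤
        (N : ℝ) * Fintype.card S * Fintype.card A * H →
      ∀ (Ω : Type*) [MeasurableSpace Ω] (μ : MeasureTheory.Measure Ω)
        [MeasureTheory.IsProbabilityMeasure μ] (X : Ω → Dataset S A H N),
        IsGenerativeSample M μ X →
        1 - δ ≤ μ.real {ω | ∀ π : Policy S A H, IsRPVLOutput M.reward ρ (X ω) π →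
          ‖M.optRobustValue ρ 0 - M.robustValue ρ π 0‖ ≤ ε}) ∧
    -- and without a threshold, on the event that the dual variables are bounded below
    (∀ lam ∈ Set.Ioo (0 : ℝ) 1, ∀ ε ∈ Set.Ioo (0 : ℝ) H, ∀ N : ℕ,
      sampleSizeKL (Fintype.card S) (Fintype.card A) H ρ ε δ lam ≤
        (N : ℝ) * Fintype.card S * Fintype.card A * H →
      ∀ (Ω : Type*) [MeasurableSpace Ω] (μ : MeasureTheory.Measure Ω)
        [MeasureTheory.IsProbabilityMeasure μ] (X : Ω → Dataset S A H N),
        IsGenerativeSample M μ X →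
        μ.real {ω | M.DualsBoundedBelow ρ lam (X ω) ∧
          ∃ π : Policy S A H, IsRPVLOutput M.reward ρ (X ω) π ∧
            ε < ‖M.optRobustValue ρ 0 - M.robustValue ρ π 0‖} ≤ δ) := by
  refine ⟨?_, fun lam hlam ε hε N hN Ω _ μ _ X hX => ?_⟩
  · rcases Nat.eq_zero_or_pos H with rfl | hH
    · exact ⟨0, fun ε hε => absurd (hε.1.trans hε.2) (by simp)⟩
    obtain ⟨η₀, hη₀, hstab⟩ := exists_forall_isStabilityRadius M hH hρ
    obtain ⟨N₀, hN₀⟩ := exists_forall_mul_two_mul_exp_le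
      (C := H * Fintype.card S ^ 2 * Fintype.card A) hη₀ (half_pos hδ.1)
    exact ⟨N₀, fun ε hε N hNN₀ hN Ω _ μ _ X hX => hX.one_sub_le_measureReal_norm_le hρ hδ hH hε.1
      (dualLowerBound_mem_Ioc M hH) hη₀.le hstab (hN₀ N hNN₀) hN⟩
  · exact (hX.measureReal_dualsBoundedBelow_and_lt_norm_le hρ hδ hlam
      (Nat.cast_pos.1 (hε.1.trans hε.2)) hε.1 hN).trans (half_le_self hδ.1.le)
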